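/- Let $v\in L^\infty(\mathbb{R})$ be real-valued with $v\ge 0$ almost everywhere. For $L>0$ let $I=(-L/2,L/2)$ and let $h_L=-\frac{d^2}{dx^2}+v$ be the Schrödinger operator in $L^2(I)$ with Neumann boundary conditions, that is, with domain $\{u\in H^2(I): u'(-L/2)=u'(L/2)=0\}$. Let $\lambda_0(L)\le\lambda_1(L)\le\cdots$ denote the eigenvalues of $h_L$ in increasing order, counted with multiplicity, and let $\Gamma_v(L)=\lambda_1(L)-\lambda_0(L)$ be the spectral gap. Then, for every $L>0$, $$\Gamma_v(L)\ \ge\ e^{-8L\|v\|_{L^1(I)}}\cdot\frac{\pi^2}{L^2},\qquad \|v\|_{L^1(I)}=\int_{-L/2}^{L/2}|v(x)|\,dx .$$ -/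

import Mathlib

open MeasureTheory Set

noncomputable section

namespace NeumannSchrodinger

/-- The Hilbert space `L²(I; ℂ)` over the interval `I = (-L/2, L/2)`. -/
abbrev L2 (L : ℝ) : Type := Lp ℂ 2 (volume.restrict (Ioo (-L / 2) (L / 2)))

/-- `f` is a function in `H²(I)` satisfying the Neumann conditions `f'(-L/2) = f'(L/2) = 0`, with
first derivative `f₁` and second (weak) derivative `f₂`: on the closed interval `f` is
differentiable with derivative `f₁`, and `f₁` is absolutely continuous, being the integral of the
square-integrable function `f₂` (the integral representation includes `f₁ (-L/2) = 0`). -/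
structure IsNeumannH2 (L : ℝ) (f f₁ f₂ : ℝ → ℂ) : Prop where
  hasDeriv : ∀ x ∈ Icc (-L / 2) (L / 2), HasDerivWithinAt f (f₁ x) (Icc (-L / 2) (L / 2)) x
  memLp : MemLp f₂ 2 (volume.restrict (Ioo (-L / 2) (L / 2)))
  eq_integral : ∀ x ∈ Icc (-L / 2) (L / 2), f₁ x = ∫ t in (-L / 2)..x, f₂ t
  left_bc : f₁ (-L / 2) = 0
  right_bc : f₁ (L / 2) = 0

theorem IsNeumannH2.zero (L : ℝ) : IsNeumannH2 L 0 0 0 where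
  hasDeriv x _ := hasDerivWithinAt_const x _ (0 : ℂ)
  memLp := MemLp.zero
  eq_integral x _ := by simp
  left_bc := rfl
  right_bc := rfl

theorem IsNeumannH2.intervalIntegrable {L : ℝ} {f f₁ f₂ : ℝ → ℂ} (h : IsNeumannH2 L f f₁ f₂)
    {x : ℝ} (hx : x ∈ Icc (-L / 2) (L / 2)) : IntervalIntegrable f₂ volume (-L / 2) x := by
  rw [intervalIntegrable_iff_integrableOn_Ioo_of_le hx.1]
  have h1 : IntegrableOn f₂ (Ioo (-L / 2) (L / 2)) := h.memLp.integrable (by norm_num)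
  exact h1.mono_set (Ioo_subset_Ioo_right hx.2)

theorem IsNeumannH2.add {L : ℝ} {f f₁ f₂ g g₁ g₂ : ℝ → ℂ} (hf : IsNeumannH2 L f f₁ f₂)
    (hg : IsNeumannH2 L g g₁ g₂) : IsNeumannH2 L (f + g) (f₁ + g₁) (f₂ + g₂) where
  hasDeriv x hx := (hf.hasDeriv x hx).add (hg.hasDeriv x hx)
  memLp := hf.memLp.add hg.memLp
  eq_integral x hx := by
    simp only [Pi.add_apply]
    rw [intervalIntegral.integral_add (hf.intervalIntegrable hx) (hg.intervalIntegrable hx),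
      hf.eq_integral x hx, hg.eq_integral x hx]
  left_bc := by simp [hf.left_bc, hg.left_bc]
  right_bc := by simp [hf.right_bc, hg.right_bc]

theorem IsNeumannH2.smul {L : ℝ} {f f₁ f₂ : ℝ → ℂ} (c : ℂ) (hf : IsNeumannH2 L f f₁ f₂) :
    IsNeumannH2 L (c • f) (c • f₁) (c • f₂) where
  hasDeriv x hx := (hf.hasDeriv x hx).const_smul c
  memLp := hf.memLp.const_smul c
  eq_integral x hx := by
    simp only [Pi.smul_apply]
    rw [intervalIntegral.integral_smul, hf.eq_integral x hx]
  left_bc := by simp [hf.left_bc]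
  right_bc := by simp [hf.right_bc]

/-- The graph of `h_L = -d²/dx² + v` with Neumann boundary conditions: the pairs `(u, w)` in
`L²(I) × L²(I)` such that `u` has a representative `f ∈ H²(I)` with `f'(±L/2) = 0` and
`w = -f'' + v f` almost everywhere on `I`. -/
def graph (v : ℝ → ℝ) (L : ℝ) : Submodule ℂ (L2 L × L2 L) where
  carrier := {p | ∃ f f₁ f₂ : ℝ → ℂ, IsNeumannH2 L f f₁ f₂ ∧
    (p.1 : ℝ → ℂ) =ᵐ[volume.restrict (Ioo (-L / 2) (L / 2))] f ∧
    (p.2 : ℝ → ℂ) =ᵐ[volume.restrict (Ioo (-L / 2) (L / 2))] fun x => -f₂ x + (v x : ℂ) * f x}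
  zero_mem' := by
    refine ⟨0, 0, 0, IsNeumannH2.zero L, Lp.coeFn_zero _ _ _, ?_⟩
    filter_upwards [Lp.coeFn_zero ℂ 2 (volume.restrict (Ioo (-L / 2) (L / 2)))] with x hx
    simpa using hx
  add_mem' := by
    rintro ⟨u, w⟩ ⟨u', w'⟩ ⟨f, f₁, f₂, hf, hu, hw⟩ ⟨g, g₁, g₂, hg, hu', hw'⟩
    refine ⟨f + g, f₁ + g₁, f₂ + g₂, hf.add hg, ?_, ?_⟩
    · exact (Lp.coeFn_add u u').trans (hu.add hu')
    · refine (Lp.coeFn_add w w').trans ((hw.add hw').trans (ae_of_all _ fun x => ?_))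
      simp only [Pi.add_apply]
      ring
  smul_mem' := by
    rintro c ⟨u, w⟩ ⟨f, f₁, f₂, hf, hu, hw⟩
    refine ⟨c • f, c • f₁, c • f₂, hf.smul c, ?_, ?_⟩
    · exact (Lp.coeFn_smul c u).trans (hu.const_smul c)
    · refine (Lp.coeFn_smul c w).trans ((hw.const_smul c).trans (ae_of_all _ fun x => ?_))
      simp only [Pi.smul_apply, smul_eq_mul]
      ring

theorem graph_snd_eq_zero {v : ℝ → ℝ} {L : ℝ} :
    ∀ p ∈ graph v L, p.1 = 0 → p.2 = 0 := by
  rintro ⟨u, w⟩ ⟨f, f₁, f₂, hf, hu, hw⟩ h0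
  simp only at h0 hu hw ⊢
  subst h0
  have hf0 : EqOn f 0 (Ioo (-L / 2) (L / 2)) := by
    refine Measure.eqOn_open_of_ae_eq (hu.symm.trans (Lp.coeFn_zero _ _ _)) isOpen_Ioo ?_
      continuousOn_const
    intro x hx
    exact ((hf.hasDeriv x (Ioo_subset_Icc_self hx)).mono Ioo_subset_Icc_self).continuousWithinAt
  have hf1 : ∀ x ∈ Ioo (-L / 2) (L / 2), f₁ x = 0 := by
    intro x hx
    have h1 := (hf.hasDeriv x (Ioo_subset_Icc_self hx)).hasDerivAt (Icc_mem_nhds hx.1 hx.2)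
    have h2 : HasDerivAt f 0 x := (hasDerivAt_const x (0 : ℂ)).congr_of_eventuallyEq
      (Filter.eventuallyEq_of_mem (isOpen_Ioo.mem_nhds hx) hf0)
    exact h1.unique h2
  have hf2 : ∀ᵐ x ∂(volume.restrict (Ioo (-L / 2) (L / 2))), f₂ x = 0 := by
    by_cases hL : -L / 2 ≤ L / 2
    · have h1 := (hf.intervalIntegrable (right_mem_Icc.2 hL)).ae_hasDerivAt_integral
      rw [ae_restrict_iff' measurableSet_Ioo]
      filter_upwards [h1] with x hx hxI
      rw [uIcc_of_le hL] at hx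
      have h2 := hx (Ioo_subset_Icc_self hxI) _ (left_mem_Icc.2 hL)
      have h3 : HasDerivAt (fun y => ∫ t in (-L / 2)..y, f₂ t) 0 x := by
        refine (hasDerivAt_const x (0 : ℂ)).congr_of_eventuallyEq
          (Filter.eventuallyEq_of_mem (isOpen_Ioo.mem_nhds hxI) fun y hy => ?_)
        rw [← hf.eq_integral y (Ioo_subset_Icc_self hy), hf1 y hy]
      exact h2.unique h3
    · rw [Ioo_eq_empty (fun h => hL h.le)]
      simp
  refine (Lp.eq_zero_iff_ae_eq_zero).2 ?_
  filter_upwards [hw, hf2, ae_restrict_mem measurableSet_Ioo] with x h1 h2 h3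
  simp [h1, h2, hf0 h3]

/-- The Schrödinger operator `h_L = -d²/dx² + v` in `L²(I)` with Neumann boundary conditions, as an
unbounded operator; its domain consists of the `u ∈ H²(I)` with `u'(±L/2) = 0` (and
`-u'' + v u ∈ L²(I)`, which is automatic for bounded `v`). -/
def hamiltonian (v : ℝ → ℝ) (L : ℝ) : L2 L →ₗ.[ℂ] L2 L := (graph v L).toLinearPMap

theorem graph_hamiltonian (v : ℝ → ℝ) (L : ℝ) : (hamiltonian v L).graph = graph v L :=
  Submodule.toLinearPMap_graph_eq _ graph_snd_eq_zero

/-- `u` is an eigenfunction of `h_L` for the eigenvalue `ν`. -/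
def IsEigenfunction (v : ℝ → ℝ) (L ν : ℝ) (u : L2 L) : Prop :=
  u ≠ 0 ∧ ∃ hu : u ∈ (hamiltonian v L).domain, hamiltonian v L ⟨u, hu⟩ = (ν : ℂ) • u

theorem isEigenfunction_iff {v : ℝ → ℝ} {L ν : ℝ} {u : L2 L} :
    IsEigenfunction v L ν u ↔ u ≠ 0 ∧ (u, (ν : ℂ) • u) ∈ graph v L := by
  rw [← graph_hamiltonian, LinearPMap.mem_graph_iff]
  refine and_congr_right fun _ => ⟨?_, ?_⟩
  · rintro ⟨hu, h⟩
    exact ⟨⟨u, hu⟩, rfl, h⟩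
  · rintro ⟨⟨y, hy⟩, h1, h2⟩
    simp only at h1 h2
    subst h1
    exact ⟨hy, h2⟩

/-- The eigenvalues `λ₀(L) ≤ λ₁(L) ≤ …` of `h_L` in increasing order, counted with multiplicity:
`λₖ(L)` is the least (infimum of the) `μ` for which there are `k + 1` linearly independent eigenfunctions with
eigenvalues at most `μ`. -/
def eigenvalue (v : ℝ → ℝ) (L : ℝ) (k : ℕ) : ℝ :=
  sInf {μ : ℝ | ∃ u : Fin (k + 1) → L2 L, LinearIndependent ℂ u ∧
    ∀ i, ∃ ν ≤ μ, IsEigenfunction v L ν (u i)}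

/-- The spectral gap `Γ_v(L) = λ₁(L) - λ₀(L)`. -/
def spectralGap (v : ℝ → ℝ) (L : ℝ) : ℝ := eigenvalue v L 1 - eigenvalue v L 0

end NeumannSchrodinger

end

/-! Let `φ > 0` solve the Neumann problem with eigenvalue `ν`, and let `ψ ≠ 0` solve it with
eigenvalue `μ ≠ ν`. The Wronskian `W = φψ' - ψφ'` vanishes at both ends, `W' = (ν - μ)φψ` and
`(ψ/φ)' = W/φ²`. Integrating `(Wψ/φ)'` gives `(μ - ν)∫ψ² = ∫W²/φ²`. Since `W` satisfies Dirichlet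
conditions, `(π/L)²∫W² ≤ ∫W'² = (μ - ν)²∫φ²ψ²`. If `φ` stays within a factor `e` of a constant, the
two relations combine to `(π/L)² ≤ (μ - ν)e⁴` (`IsRealSolution.gap_le`).

The factor is `e = exp(L‖v‖₁)`: the logarithmic derivative `φ'/φ` solves a Riccati equation and
vanishes at both ends, which bounds it by `‖v‖₁` (`abs_logDeriv_le`).

A positive solution and a sign-changing one come from shooting: the Prüfer angle at `L/2` depends
continuously on the spectral parameter and takes the values `0` and `π` (`exists_eigenfunctions`).
The positive one identifies `λ₀` and its simplicity; the other shows that two independent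
eigenfunctions exist, so that `λ₁` is the infimum of a nonempty set. -/

noncomputable section

namespace NeumannSchrodinger

/-! ### Calculus of absolutely continuous functions. -/

/-- `F` is absolutely continuous on `[a, b]` with almost everywhere derivative `f`. -/
structure HasAEDeriv (a b : ℝ) (F f : ℝ → ℝ) : Prop where
  ac : AbsolutelyContinuousOnInterval F a b
  ae : ∀ᵐ x : ℝ, x ∈ Ioo a b → HasDerivAt F (f x) x

theorem exists_continuous_eqOn {a b : ℝ} (hab : a ≤ b) {f : ℝ → ℝ} (hf : ContinuousOn f (Icc a b)) :
    ∃ g : ℝ → ℝ, Continuous g ∧ EqOn f g (Icc a b) :=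
  ⟨IccExtend hab ((Icc a b).domRestrict f), (continuousOn_iff_continuous_domRestrict.1 hf).Icc_extend',
    fun x hx => by rw [IccExtend_of_mem hab _ hx]; rfl⟩

theorem intervalIntegrable_of_continuousOn_Icc {a b : ℝ} (hab : a ≤ b) {f : ℝ → ℝ}
    (hf : ContinuousOn f (Icc a b)) : IntervalIntegrable f volume a b :=
  ContinuousOn.intervalIntegrable (by rwa [uIcc_of_le hab])

theorem absolutelyContinuousOnInterval_of_dist_le {F H : ℝ → ℝ} {a b K : ℝ}
    (hF : AbsolutelyContinuousOnInterval F a b)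
    (h : ∀ x ∈ uIcc a b, ∀ y ∈ uIcc a b, dist (H x) (H y) ≤ K * dist (F x) (F y)) :
    AbsolutelyContinuousOnInterval H a b := by
  have h0 := Filter.Tendsto.const_mul K hF
  rw [mul_zero] at h0
  refine squeeze_zero' (Filter.Eventually.of_forall fun E =>
    Finset.sum_nonneg fun _ _ => dist_nonneg) ?_ h0
  filter_upwards [Filter.mem_inf_of_right (Filter.mem_principal_self _)] with E hE
  rw [Finset.mul_sum]
  exact Finset.sum_le_sum fun i hi => h _ (hE.1 i hi).1 _ (hE.1 i hi).2

namespace HasAEDeriv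

variable {a b : ℝ} {F f G g : ℝ → ℝ}

theorem ae_deriv_eq (h : HasAEDeriv a b F f) : ∀ᵐ x : ℝ, x ∈ Ioo a b → deriv F x = f x := by
  filter_upwards [h.ae] with x hx hxI using (hx hxI).deriv

theorem ae_deriv_eq' (h : HasAEDeriv a b F f) :
    ∀ᵐ x : ℝ, x ∈ Ioc a b → deriv F x = f x := by
  have hb : ∀ᵐ x : ℝ, x ≠ b := by simp [ae_iff, measure_singleton]
  filter_upwards [h.ae_deriv_eq, hb] with x hx hxb hxI using
    hx ⟨hxI.1, lt_of_le_of_ne hxI.2 hxb⟩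

theorem intervalIntegrable (hab : a ≤ b) (h : HasAEDeriv a b F f) :
    IntervalIntegrable f volume a b := by
  refine h.ac.intervalIntegrable_deriv.congr_ae ?_
  rw [Filter.EventuallyEq, uIoc_of_le hab, ae_restrict_iff' measurableSet_Ioc]
  exact h.ae_deriv_eq'

theorem integral_eq (h : HasAEDeriv a b F f) {x y : ℝ} (hx : a ≤ x) (hxy : x ≤ y) (hy : y ≤ b) :
    ∫ t in x..y, f t = F y - F x := by
  have hsub : uIcc x y ⊆ uIcc a b := by
    rw [uIcc_of_le hxy, uIcc_of_le (hx.trans (hxy.trans hy))]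
    exact Icc_subset_Icc hx hy
  rw [← (h.ac.mono hsub).integral_deriv_eq_sub]
  refine intervalIntegral.integral_congr_ae ?_
  filter_upwards [h.ae_deriv_eq'] with t ht htI
  rw [uIoc_of_le hxy] at htI
  exact (ht ⟨hx.trans_lt htI.1, htI.2.trans hy⟩).symm

theorem continuousOn (hab : a ≤ b) (h : HasAEDeriv a b F f) : ContinuousOn F (Icc a b) := by
  have := h.ac.continuousOn
  rwa [uIcc_of_le hab] at this

theorem mul (hF : HasAEDeriv a b F f) (hG : HasAEDeriv a b G g) :
    HasAEDeriv a b (fun x => F x * G x) (fun x => f x * G x + F x * g x) where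
  ac := hF.ac.mul hG.ac
  ae := by
    filter_upwards [hF.ae, hG.ae] with x h1 h2 hx using (h1 hx).mul (h2 hx)

theorem sub (hF : HasAEDeriv a b F f) (hG : HasAEDeriv a b G g) :
    HasAEDeriv a b (fun x => F x - G x) (fun x => f x - g x) where
  ac := hF.ac.sub hG.ac
  ae := by
    filter_upwards [hF.ae, hG.ae] with x h1 h2 hx using (h1 hx).sub (h2 hx)

theorem const_mul (c : ℝ) (hF : HasAEDeriv a b F f) :
    HasAEDeriv a b (fun x => c * F x) (fun x => c * f x) where
  ac := hF.ac.const_mul c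
  ae := by
    filter_upwards [hF.ae] with x h1 hx using (h1 hx).const_mul c

/-- The range of `F` lies in a compact interval, on which the C¹ function `G` is Lipschitz; this
preserves absolute continuity. -/
theorem comp (hF : HasAEDeriv a b F f) (hg : ∀ x, HasDerivAt G (g x) x)
    (hgc : Continuous g) : HasAEDeriv a b (fun x => G (F x)) (fun x => g (F x) * f x) where
  ac := by
    obtain ⟨B, hB⟩ := hF.ac.exists_bound
    obtain ⟨K, hK⟩ := isCompact_Icc.exists_bound_of_continuousOn (s := Icc (-B) B) hgc.continuousOn
    refine absolutelyContinuousOnInterval_of_dist_le (K := K) hF.ac fun x hx y hy => ?_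
    rw [dist_eq_norm, dist_eq_norm]
    exact (convex_Icc (-B) B).norm_image_sub_le_of_norm_hasDerivWithin_le
      (fun z _ => (hg z).hasDerivWithinAt) hK (abs_le.1 (hB y hy)) (abs_le.1 (hB x hx))
  ae := by
    filter_upwards [hF.ae] with x h1 hx using (hg (F x)).comp x (h1 hx)

theorem of_integral (hab : a ≤ b) (hf : IntervalIntegrable f volume a b)
    (h : ∀ x ∈ Icc a b, F x = F a + ∫ t in a..x, f t) : HasAEDeriv a b F f where
  ac := by
    have h1 := hf.absolutelyContinuousOnInterval_intervalIntegral (c := a) (by simp)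
    have h2 : AbsolutelyContinuousOnInterval (fun _ : ℝ => F a) a b :=
      (LipschitzWith.const (F a)).lipschitzOnWith.absolutelyContinuousOnInterval
    refine absolutelyContinuousOnInterval_of_dist_le (K := 1) (h2.add h1) fun x hx y hy => ?_
    rw [uIcc_of_le hab] at hx hy
    rw [h x hx, h y hy, one_mul]
    simp
  ae := by
    filter_upwards [hf.ae_hasDerivAt_integral] with x hx hxI
    have hxI' := Ioo_subset_Icc_self hxI
    refine ((hx (by rwa [uIcc_of_le hab]) a (by simp)).const_add (F a)).congr_of_eventuallyEq ?_
    filter_upwards [Icc_mem_nhds hxI.1 hxI.2] with y hy using h y hy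

theorem of_hasDerivWithinAt (hab : a ≤ b)
    (h : ∀ x ∈ Icc a b, HasDerivWithinAt F (f x) (Icc a b) x) (hf : ContinuousOn f (Icc a b)) :
    HasAEDeriv a b F f := by
  refine of_integral hab (intervalIntegrable_of_continuousOn_Icc hab hf) fun x hx => ?_
  rw [intervalIntegral.integral_eq_sub_of_hasDerivAt_of_le hx.1 (f := F)]
  · ring
  · exact fun y hy => ((h y ⟨hy.1, hy.2.trans hx.2⟩).mono
      (Icc_subset_Icc_right hx.2)).continuousWithinAt
  · exact fun y hy => (h y ⟨hy.1.le, hy.2.le.trans hx.2⟩).hasDerivAt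
      (Icc_mem_nhds hy.1 (hy.2.trans_le hx.2))
  · exact intervalIntegrable_of_continuousOn_Icc hx.1 (hf.mono (Icc_subset_Icc_right hx.2))

/-- An absolutely continuous function whose a.e. derivative has a continuous version is C¹. This
recovers classical derivatives once the merely measurable `v` has cancelled, as it does in the
Wronskian. -/
theorem hasDerivWithinAt (hab : a ≤ b) (h : HasAEDeriv a b F f) (hf : ContinuousOn f (Icc a b))
    {x : ℝ} (hx : x ∈ Icc a b) : HasDerivWithinAt F (f x) (Icc a b) x := by
  obtain ⟨g, hg, hfg⟩ := exists_continuous_eqOn hab hf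
  have key : ∀ y ∈ Icc a b, F y = F a + ∫ t in a..y, g t := by
    intro y hy
    rw [← intervalIntegral.integral_congr (f := f), h.integral_eq le_rfl hy.1 hy.2]
    · ring
    · intro t ht
      rw [uIcc_of_le hy.1] at ht
      exact hfg ⟨ht.1, ht.2.trans hy.2⟩
  rw [hfg hx]
  exact ((hg.integral_hasStrictDerivAt a x).hasDerivAt.const_add
    (F a)).hasDerivWithinAt.congr key (key x hx)

theorem congr_right (h : HasAEDeriv a b F f) (hfg : ∀ x ∈ Ioo a b, f x = g x) :
    HasAEDeriv a b F g where
  ac := h.ac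
  ae := by
    filter_upwards [h.ae] with x h1 hx
    rw [← hfg x hx]
    exact h1 hx

end HasAEDeriv

/-- A barrier argument for functions without pointwise derivatives: `θ` cannot cross the level `c`
downwards if it increases while near `c`. It goes by continuous induction: above `c` continuity
suffices, and at `c` the function stays within `δ` for a while. -/
theorem le_of_forall_near_monotone {θ : ℝ → ℝ} {a b c δ : ℝ} (hδ : 0 < δ)
    (hθ : ContinuousOn θ (Icc a b)) (ha : c ≤ θ a)
    (h : ∀ x y, a ≤ x → x ≤ y → y ≤ b → (∀ t ∈ Icc x y, |θ t - c| < δ) → θ x ≤ θ y)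
    {x : ℝ} (hx : x ∈ Icc a b) : c ≤ θ x := by
  have hab : a ≤ b := hx.1.trans hx.2
  refine IsClosed.Icc_subset_of_forall_exists_gt (s := {t | c ≤ θ t}) ?_ ha ?_ hx
  · have := hθ.preimage_isClosed_of_isClosed isClosed_Icc (isClosed_Ici (a := c))
    rwa [inter_comm] at this
  · rintro x ⟨hxc, hax, hxb⟩ y hy
    have hcont := hθ x ⟨hax, hxb.le⟩
    have hev : ∀ ε > 0, ∃ z, x < z ∧ z ≤ y ∧ z ≤ b ∧ ∀ t ∈ Icc x z, |θ t - θ x| < ε := by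
      intro ε hε
      obtain ⟨η, hη, H⟩ := Metric.continuousWithinAt_iff.1 hcont ε hε
      have hy' : x < y := hy
      refine ⟨min (min y b) (x + η / 2), ?_, ?_, ?_, ?_⟩
      · simp only [lt_min_iff]; exact ⟨⟨hy, hxb⟩, by linarith⟩
      · exact (min_le_left _ _).trans (min_le_left _ _)
      · exact (min_le_left _ _).trans (min_le_right _ _)
      · intro t ht
        have h1 := ht.2.trans (min_le_right _ _)
        have h2 := ht.2.trans ((min_le_left _ _).trans (min_le_right _ _))
        have := H (x := t) ⟨hax.trans ht.1, h2⟩ (by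
          rw [Real.dist_eq, abs_of_nonneg (by linarith [ht.1])]; linarith)
        rwa [Real.dist_eq] at this
    have hxc' : c ≤ θ x := hxc
    rcases hxc'.eq_or_lt with heq | hlt
    · obtain ⟨z, hxz, hzy, hzb, H⟩ := hev δ hδ
      refine ⟨z, ?_, hxz, hzy⟩
      rw [← heq] at H
      exact hxc'.trans (h x z hax hxz.le hzb H)
    · obtain ⟨z, hxz, hzy, hzb, H⟩ := hev (θ x - c) (by linarith)
      refine ⟨z, ?_, hxz, hzy⟩
      have := (abs_lt.1 (H z ⟨hxz.le, le_rfl⟩)).1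
      change c ≤ θ z
      linarith

/-! ### The Dirichlet Wirtinger inequality. -/

/-- With `c = -ω tan(ωx)`, so that `c' = -ω² - c²`, completing the square gives `W'² - ω²W² = (W' -
cW)² + (cW²)'`, and the last term integrates to zero. The strict bound `ω < π/L` keeps the tangent
finite on the closed interval. -/
theorem dirichlet_wirtinger_of_lt {L ω : ℝ} (hL : 0 < L) (hω : 0 ≤ ω) (hωL : ω < Real.pi / L)
    {W W' : ℝ → ℝ} (hW : ∀ x ∈ Icc (-L / 2) (L / 2), HasDerivWithinAt W (W' x) (Icc (-L / 2) (L / 2)) x)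
    (hW' : ContinuousOn W' (Icc (-L / 2) (L / 2))) (h0 : W (-L / 2) = 0) (h1 : W (L / 2) = 0) :
    ω ^ 2 * ∫ x in (-L / 2)..(L / 2), W x ^ 2 ≤ ∫ x in (-L / 2)..(L / 2), W' x ^ 2 := by
  have hab : -L / 2 ≤ L / 2 := by linarith
  have hωL' : ω * L < Real.pi := (lt_div_iff₀ hL).1 hωL
  have hcos : ∀ x ∈ Icc (-L / 2) (L / 2), Real.cos (ω * x) ≠ 0 := by
    intro x hx
    refine (Real.cos_pos_of_mem_Ioo ⟨?_, ?_⟩).ne'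
    · nlinarith [mul_le_mul_of_nonneg_left hx.1 hω]
    · nlinarith [mul_le_mul_of_nonneg_left hx.2 hω]
  have hWc : ContinuousOn W (Icc (-L / 2) (L / 2)) := fun x hx => (hW x hx).continuousWithinAt
  set c : ℝ → ℝ := fun x => -ω * Real.tan (ω * x) with hc
  have hcd : ∀ x ∈ Icc (-L / 2) (L / 2), HasDerivAt c (-ω ^ 2 - c x ^ 2) x := by
    intro x hx
    have h1 := ((Real.hasDerivAt_tan (hcos x hx)).comp x
      ((hasDerivAt_id x).const_mul ω)).const_mul (-ω)
    refine h1.congr_deriv ?_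
    simp only [hc, Real.tan_eq_sin_div_cos]
    have := hcos x hx
    field_simp
    nlinarith [Real.sin_sq_add_cos_sq (ω * x)]
  have hcc : ContinuousOn c (Icc (-L / 2) (L / 2)) :=
    fun x hx => (hcd x hx).continuousAt.continuousWithinAt
  have hint : ∫ x in (-L / 2)..(L / 2), ((-ω ^ 2 - c x ^ 2) * W x ^ 2 + c x * (2 * W x * W' x)) = 0 := by
    rw [intervalIntegral.integral_eq_sub_of_hasDerivAt_of_le hab (f := fun x => c x * W x ^ 2)]
    · simp [h0, h1]
    · exact hcc.mul (hWc.pow 2)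
    · intro x hx
      have hx' := Ioo_subset_Icc_self hx
      have h2 := ((hW x hx').hasDerivAt (Icc_mem_nhds hx.1 hx.2)).pow 2
      refine ((hcd x hx').mul h2).congr_deriv ?_
      simp
    · exact intervalIntegrable_of_continuousOn_Icc hab (by fun_prop)
  have hI1 : IntervalIntegrable (fun x => W x ^ 2) volume (-L / 2) (L / 2) :=
    intervalIntegrable_of_continuousOn_Icc hab (hWc.pow 2)
  have hI2 : IntervalIntegrable (fun x => W' x ^ 2) volume (-L / 2) (L / 2) :=
    intervalIntegrable_of_continuousOn_Icc hab (hW'.pow 2)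
  have hI3 : IntervalIntegrable (fun x => (-ω ^ 2 - c x ^ 2) * W x ^ 2 + c x * (2 * W x * W' x))
      volume (-L / 2) (L / 2) := intervalIntegrable_of_continuousOn_Icc hab (by fun_prop)
  have : ∫ x in (-L / 2)..(L / 2), (ω ^ 2 * W x ^ 2 +
      ((-ω ^ 2 - c x ^ 2) * W x ^ 2 + c x * (2 * W x * W' x))) ≤
      ∫ x in (-L / 2)..(L / 2), W' x ^ 2 := by
    refine intervalIntegral.integral_mono_on hab ((hI1.const_mul _).add hI3) hI2 fun x _ => ?_
    nlinarith [sq_nonneg (W' x - c x * W x)]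
  rwa [intervalIntegral.integral_add (hI1.const_mul _) hI3, hint, add_zero,
    intervalIntegral.integral_const_mul] at this

/-- The Dirichlet Wirtinger inequality on `[-L/2, L/2]`. -/
theorem dirichlet_wirtinger {L : ℝ} (hL : 0 < L)
    {W W' : ℝ → ℝ} (hW : ∀ x ∈ Icc (-L / 2) (L / 2), HasDerivWithinAt W (W' x) (Icc (-L / 2) (L / 2)) x)
    (hW' : ContinuousOn W' (Icc (-L / 2) (L / 2))) (h0 : W (-L / 2) = 0) (h1 : W (L / 2) = 0) :
    (Real.pi / L) ^ 2 * ∫ x in (-L / 2)..(L / 2), W x ^ 2 ≤ ∫ x in (-L / 2)..(L / 2), W' x ^ 2 := by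
  have hpos : 0 < Real.pi / L := by positivity
  have hcont : Filter.Tendsto (fun ω : ℝ => ω ^ 2 * ∫ x in (-L / 2)..(L / 2), W x ^ 2)
      (nhdsWithin (Real.pi / L) (Iio (Real.pi / L)))
      (nhds ((Real.pi / L) ^ 2 * ∫ x in (-L / 2)..(L / 2), W x ^ 2)) :=
    (Continuous.tendsto (by fun_prop) _).mono_left nhdsWithin_le_nhds
  refine le_of_tendsto hcont ?_
  filter_upwards [Ioo_mem_nhdsLT hpos] with ω hω
  exact dirichlet_wirtinger_of_lt hL hω.1.le hω.2 hW hW' h0 h1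

/-! ### Real Neumann solutions and the gap estimate. -/

/-- `y` is a real solution, with derivative `y₁`, of `-y'' + v y = ν y` on `[-L/2, L/2]` with
Neumann boundary conditions. -/
structure IsRealSolution (v : ℝ → ℝ) (L ν : ℝ) (y y₁ : ℝ → ℝ) : Prop where
  hasDeriv : ∀ x ∈ Icc (-L / 2) (L / 2), HasDerivWithinAt y (y₁ x) (Icc (-L / 2) (L / 2)) x
  eq_integral : ∀ x ∈ Icc (-L / 2) (L / 2), y₁ x = ∫ t in (-L / 2)..x, (v t - ν) * y t
  right_bc : y₁ (L / 2) = 0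

namespace IsRealSolution

variable {v : ℝ → ℝ} {L ν μ : ℝ} {y y₁ φ φ₁ ψ ψ₁ : ℝ → ℝ}

theorem continuousOn (h : IsRealSolution v L ν y y₁) : ContinuousOn y (Icc (-L / 2) (L / 2)) :=
  fun x hx => (h.hasDeriv x hx).continuousWithinAt

theorem left_bc (hL : 0 < L) (h : IsRealSolution v L ν y y₁) : y₁ (-L / 2) = 0 := by
  rw [h.eq_integral _ (left_mem_Icc.2 (by linarith)), intervalIntegral.integral_same]

theorem intervalIntegrable (hL : 0 < L) (hv : IntervalIntegrable v volume (-L / 2) (L / 2))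
    (h : IsRealSolution v L ν y y₁) :
    IntervalIntegrable (fun t => (v t - ν) * y t) volume (-L / 2) (L / 2) := by
  refine (hv.sub intervalIntegrable_const).mul_continuousOn ?_
  rw [uIcc_of_le (by linarith)]
  exact h.continuousOn

theorem hasAEDeriv_deriv (hL : 0 < L) (hv : IntervalIntegrable v volume (-L / 2) (L / 2))
    (h : IsRealSolution v L ν y y₁) :
    HasAEDeriv (-L / 2) (L / 2) y₁ (fun t => (v t - ν) * y t) :=
  .of_integral (by linarith) (h.intervalIntegrable hL hv) fun x hx => by
    rw [h.left_bc hL, zero_add, h.eq_integral x hx]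

theorem continuousOn_deriv (hL : 0 < L) (hv : IntervalIntegrable v volume (-L / 2) (L / 2))
    (h : IsRealSolution v L ν y y₁) : ContinuousOn y₁ (Icc (-L / 2) (L / 2)) :=
  (h.hasAEDeriv_deriv hL hv).continuousOn (by linarith)

theorem hasAEDeriv (hL : 0 < L) (hv : IntervalIntegrable v volume (-L / 2) (L / 2))
    (h : IsRealSolution v L ν y y₁) : HasAEDeriv (-L / 2) (L / 2) y y₁ :=
  .of_hasDerivWithinAt (by linarith) h.hasDeriv (h.continuousOn_deriv hL hv)

/-- Integrating the equation gives `∫(v - ν)φ = 0`, impossible for `ν < 0` because the integrand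
would be positive. -/
theorem nonneg_of_pos (hL : 0 < L) (hv : IntervalIntegrable v volume (-L / 2) (L / 2))
    (hv0 : ∀ x, 0 ≤ v x) (h : IsRealSolution v L ν φ φ₁)
    (hφ : ∀ x ∈ Icc (-L / 2) (L / 2), 0 < φ x) : 0 ≤ ν := by
  have hab : -L / 2 < L / 2 := by linarith
  by_contra! hν
  have h0 : ∫ t in (-L / 2)..(L / 2), (v t - ν) * φ t = 0 := by
    rw [← h.eq_integral _ (right_mem_Icc.2 hab.le), h.right_bc]
  refine h0.not_gt (intervalIntegral.intervalIntegral_pos_of_pos_on (h.intervalIntegrable hL hv)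
    (fun x hx => mul_pos (by linarith [hv0 x]) (hφ x (Ioo_subset_Icc_self hx))) hab)

/-- `Q = φ'/φ` satisfies `Q' = v - ν - Q² ≤ v`, so it rises by at most `∫v` over any subinterval. As
`Q` vanishes at both ends, comparison with the left end bounds it above and with the right end
below. -/
theorem abs_logDeriv_le (hL : 0 < L) (hv : IntervalIntegrable v volume (-L / 2) (L / 2))
    (hv0 : ∀ x, 0 ≤ v x) (h : IsRealSolution v L ν φ φ₁)
    (hφ : ∀ x ∈ Icc (-L / 2) (L / 2), 0 < φ x) {x : ℝ} (hx : x ∈ Icc (-L / 2) (L / 2)) :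
    |φ₁ x / φ x| ≤ ∫ t in (-L / 2)..(L / 2), v t := by
  have hab : -L / 2 ≤ L / 2 := by linarith
  have hν := h.nonneg_of_pos hL hv hv0 hφ
  have hinv : HasAEDeriv (-L / 2) (L / 2) (fun x => (φ x)⁻¹) (fun x => -φ₁ x / φ x ^ 2) :=
    .of_hasDerivWithinAt hab (fun x hx => (h.hasDeriv x hx).inv (hφ x hx).ne')
      ((h.continuousOn_deriv hL hv).neg.div (h.continuousOn.pow 2)
        fun x hx => (pow_pos (hφ x hx) 2).ne')
  have hQ : HasAEDeriv (-L / 2) (L / 2) (fun x => φ₁ x * (φ x)⁻¹)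
      (fun x => v x - ν - (φ₁ x / φ x) ^ 2) := by
    refine ((h.hasAEDeriv_deriv hL hv).mul hinv).congr_right fun x hx => ?_
    have := (hφ x (Ioo_subset_Icc_self hx)).ne'
    field_simp
    ring
  have hle : ∀ a b, -L / 2 ≤ a → a ≤ b → b ≤ L / 2 →
      φ₁ b * (φ b)⁻¹ - φ₁ a * (φ a)⁻¹ ≤ ∫ t in (-L / 2)..(L / 2), v t := by
    intro a b ha hab' hb
    have hsub : uIcc a b ⊆ uIcc (-L / 2) (L / 2) := by
      rw [uIcc_of_le hab', uIcc_of_le hab]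
      exact Icc_subset_Icc ha hb
    rw [← hQ.integral_eq ha hab' hb]
    calc _ ≤ ∫ t in a..b, v t := intervalIntegral.integral_mono_on hab'
            ((hQ.intervalIntegrable hab).mono_set hsub) (hv.mono_set hsub)
            fun t _ => by nlinarith [sq_nonneg (φ₁ t / φ t)]
      _ ≤ _ := intervalIntegral.integral_mono_interval ha hab' hb
          (Filter.Eventually.of_forall hv0) hv
  rw [div_eq_mul_inv, abs_le]
  have h1 := hle _ _ hx.1 hx.2 le_rfl
  have h2 := hle _ _ le_rfl hx.1 hx.2
  rw [h.right_bc] at h1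
  rw [h.left_bc hL] at h2
  constructor <;> linarith

theorem abs_log_sub_le (hL : 0 < L) (hv : IntervalIntegrable v volume (-L / 2) (L / 2))
    (hv0 : ∀ x, 0 ≤ v x) (h : IsRealSolution v L ν φ φ₁)
    (hφ : ∀ x ∈ Icc (-L / 2) (L / 2), 0 < φ x) {x : ℝ} (hx : x ∈ Icc (-L / 2) (L / 2)) :
    |Real.log (φ x) - Real.log (φ (-L / 2))| ≤ (∫ t in (-L / 2)..(L / 2), v t) * L := by
  have hab : -L / 2 ≤ L / 2 := by linarith
  have := (convex_Icc (-L / 2) (L / 2)).norm_image_sub_le_of_norm_hasDerivWithin_le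
    (f := fun x => Real.log (φ x)) (f' := fun x => φ₁ x / φ x)
    (fun z hz => (h.hasDeriv z hz).log (hφ z hz).ne')
    (fun z hz => h.abs_logDeriv_le hL hv hv0 hφ hz) (left_mem_Icc.2 hab) hx
  refine this.trans ?_
  have hN : 0 ≤ ∫ t in (-L / 2)..(L / 2), v t :=
    intervalIntegral.integral_nonneg hab fun x _ => hv0 x
  refine mul_le_mul_of_nonneg_left ?_ hN
  rw [Real.norm_eq_abs, abs_of_nonneg (by linarith [hx.1])]
  linarith [hx.2]

/-- A Harnack inequality: it lets the weights `φ²` and `φ⁻²` be replaced by constants. -/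
theorem le_exp_mul_left (hL : 0 < L) (hv : IntervalIntegrable v volume (-L / 2) (L / 2))
    (hv0 : ∀ x, 0 ≤ v x) (h : IsRealSolution v L ν φ φ₁)
    (hφ : ∀ x ∈ Icc (-L / 2) (L / 2), 0 < φ x) {x : ℝ} (hx : x ∈ Icc (-L / 2) (L / 2)) :
    φ x ≤ Real.exp ((∫ t in (-L / 2)..(L / 2), v t) * L) * φ (-L / 2) ∧
    φ (-L / 2) ≤ Real.exp ((∫ t in (-L / 2)..(L / 2), v t) * L) * φ x := by
  have h1 := abs_le.1 (h.abs_log_sub_le hL hv hv0 hφ hx)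
  have ha := hφ _ (left_mem_Icc.2 (show -L / 2 ≤ L / 2 by linarith))
  have hx := hφ x hx
  constructor
  · rw [← Real.log_le_log_iff hx (by positivity), Real.log_mul (by positivity) ha.ne', Real.log_exp]
    linarith
  · rw [← Real.log_le_log_iff ha (by positivity), Real.log_mul (by positivity) hx.ne', Real.log_exp]
    linarith

theorem hasDerivWithinAt_wronskian (hL : 0 < L)
    (hv : IntervalIntegrable v volume (-L / 2) (L / 2))
    (hφ : IsRealSolution v L ν φ φ₁) (hψ : IsRealSolution v L μ ψ ψ₁)
    {x : ℝ} (hx : x ∈ Icc (-L / 2) (L / 2)) :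
    HasDerivWithinAt (fun x => φ x * ψ₁ x - ψ x * φ₁ x) ((ν - μ) * (φ x * ψ x))
      (Icc (-L / 2) (L / 2)) x := by
  have h := ((hφ.hasAEDeriv hL hv).mul (hψ.hasAEDeriv_deriv hL hv)).sub
    ((hψ.hasAEDeriv hL hv).mul (hφ.hasAEDeriv_deriv hL hv))
  exact (h.congr_right (g := fun x => (ν - μ) * (φ x * ψ x)) fun x _ => by ring).hasDerivWithinAt
    (by linarith) (continuousOn_const.mul (hφ.continuousOn.mul hψ.continuousOn)) hx

theorem hasDerivWithinAt_div (hφ : IsRealSolution v L ν φ φ₁) (hψ : IsRealSolution v L μ ψ ψ₁)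
    (hpos : ∀ x ∈ Icc (-L / 2) (L / 2), 0 < φ x) {x : ℝ} (hx : x ∈ Icc (-L / 2) (L / 2)) :
    HasDerivWithinAt (fun x => ψ x / φ x) ((φ x * ψ₁ x - ψ x * φ₁ x) / φ x ^ 2)
      (Icc (-L / 2) (L / 2)) x :=
  ((hψ.hasDeriv x hx).div (hφ.hasDeriv x hx) (hpos x hx).ne').congr_deriv (by ring)

/-- For equal eigenvalues the Wronskian is constant, hence zero by the boundary conditions, so `ψ/φ`
is constant. -/
theorem eq_const_mul (hL : 0 < L) (hv : IntervalIntegrable v volume (-L / 2) (L / 2))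
    (hφ : IsRealSolution v L ν φ φ₁) (hψ : IsRealSolution v L ν ψ ψ₁)
    (hpos : ∀ x ∈ Icc (-L / 2) (L / 2), 0 < φ x) :
    ∃ c : ℝ, ∀ x ∈ Icc (-L / 2) (L / 2), ψ x = c * φ x := by
  have hab : -L / 2 ≤ L / 2 := by linarith
  have ha := left_mem_Icc.2 hab
  have const : ∀ {F f : ℝ → ℝ},
      (∀ x ∈ Icc (-L / 2) (L / 2), HasDerivWithinAt F (f x) (Icc (-L / 2) (L / 2)) x) →
      (∀ x ∈ Icc (-L / 2) (L / 2), f x = 0) → ∀ x ∈ Icc (-L / 2) (L / 2), F x = F (-L / 2) := by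
    intro F f hF hf x hx
    have := (convex_Icc (-L / 2) (L / 2)).norm_image_sub_le_of_norm_hasDerivWithin_le (C := 0) hF
      (fun z hz => by rw [hf z hz, norm_zero]) ha hx
    rw [zero_mul, norm_le_zero_iff, sub_eq_zero] at this
    exact this
  have hW := const (fun x hx => hφ.hasDerivWithinAt_wronskian hL hv hψ hx) (by simp)
  have hg := const (fun x hx => hφ.hasDerivWithinAt_div hψ hpos hx) fun x hx => by
    rw [hW x hx, hφ.left_bc hL, hψ.left_bc hL]
    simp
  refine ⟨ψ (-L / 2) / φ (-L / 2), fun x hx => ?_⟩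
  rw [← hg x hx, div_mul_cancel₀ _ (hpos x hx).ne']

/-- The gap between the eigenvalue of a positive Neumann eigenfunction and any other eigenvalue. -/
theorem gap_le (hL : 0 < L) (hv : IntervalIntegrable v volume (-L / 2) (L / 2))
    (hv0 : ∀ x, 0 ≤ v x) (hφ : IsRealSolution v L ν φ φ₁) (hψ : IsRealSolution v L μ ψ ψ₁)
    (hpos : ∀ x ∈ Icc (-L / 2) (L / 2), 0 < φ x) (hne : ∃ x ∈ Icc (-L / 2) (L / 2), ψ x ≠ 0)
    (hνμ : μ ≠ ν) :
    Real.exp (-8 * L * ∫ t in (-L / 2)..(L / 2), v t) * (Real.pi ^ 2 / L ^ 2) ≤ μ - ν := by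
  have hab : -L / 2 < L / 2 := by linarith
  have ha := left_mem_Icc.2 hab.le
  have hφc := hφ.continuousOn
  have hψc := hψ.continuousOn
  have hφ1c := hφ.continuousOn_deriv hL hv
  have hψ1c := hψ.continuousOn_deriv hL hv
  have hne' : ∀ x ∈ Icc (-L / 2) (L / 2), φ x ^ 2 ≠ 0 := fun x hx => (pow_pos (hpos x hx) 2).ne'
  set W : ℝ → ℝ := fun x => φ x * ψ₁ x - ψ x * φ₁ x with hW
  have hWc : ContinuousOn W (Icc (-L / 2) (L / 2)) := by fun_prop
  have hWd : ∀ x ∈ Icc (-L / 2) (L / 2), HasDerivWithinAt W ((ν - μ) * (φ x * ψ x))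
      (Icc (-L / 2) (L / 2)) x := fun x hx => hφ.hasDerivWithinAt_wronskian hL hv hψ hx
  have hWa : W (-L / 2) = 0 := by simp [hW, hφ.left_bc hL, hψ.left_bc hL]
  have hWb : W (L / 2) = 0 := by simp [hW, hφ.right_bc, hψ.right_bc]
  have hI : ∀ {f : ℝ → ℝ}, ContinuousOn f (Icc (-L / 2) (L / 2)) →
      IntervalIntegrable f volume (-L / 2) (L / 2) :=
    fun hf => intervalIntegrable_of_continuousOn_Icc hab.le hf
  have hWφ : ContinuousOn (fun x => W x ^ 2 / φ x ^ 2) (Icc (-L / 2) (L / 2)) :=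
    (hWc.pow 2).div (hφc.pow 2) hne'
  -- the Rayleigh identity
  have hid : (μ - ν) * ∫ x in (-L / 2)..(L / 2), ψ x ^ 2 =
      ∫ x in (-L / 2)..(L / 2), W x ^ 2 / φ x ^ 2 := by
    have := intervalIntegral.integral_deriv_mul_eq_sub_of_hasDerivWithinAt
      (a := -L / 2) (b := L / 2) (u := W) (v := fun x => ψ x / φ x)
      (u' := fun x => (ν - μ) * (φ x * ψ x)) (v' := fun x => W x / φ x ^ 2)
      (by rw [uIcc_of_le hab.le]; exact hWd)
      (by rw [uIcc_of_le hab.le]; exact fun x hx => hφ.hasDerivWithinAt_div hψ hpos hx)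
      (hI (by fun_prop)) (hI (hWc.div (hφc.pow 2) hne'))
    rw [hWa, hWb, zero_mul, zero_mul, sub_zero] at this
    have h2 : ∫ x in (-L / 2)..(L / 2), ((ν - μ) * ψ x ^ 2 + W x ^ 2 / φ x ^ 2) = 0 := by
      rw [← this]
      refine intervalIntegral.integral_congr fun x hx => ?_
      rw [uIcc_of_le hab.le] at hx
      have := (hpos x hx).ne'
      field_simp
    rw [intervalIntegral.integral_add ((hI (by fun_prop)).const_mul _) (hI hWφ),
      intervalIntegral.integral_const_mul] at h2
    linarith
  have hψpos : 0 < ∫ x in (-L / 2)..(L / 2), ψ x ^ 2 := by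
    obtain ⟨x, hx, hx0⟩ := hne
    exact intervalIntegral.integral_pos hab (hψc.pow 2) (fun _ _ => sq_nonneg _)
      ⟨x, hx, by positivity⟩
  -- The sign of the gap is read off the Rayleigh identity; no ordering of the eigenvalues is
  -- assumed.
  have hΓ : 0 < μ - ν := by
    refine lt_of_le_of_ne ?_ (sub_ne_zero.2 hνμ).symm
    refine nonneg_of_mul_nonneg_left ?_ hψpos
    rw [hid]
    exact intervalIntegral.integral_nonneg hab.le fun x _ => by positivity
  set e := Real.exp ((∫ t in (-L / 2)..(L / 2), v t) * L) with he
  set m := φ (-L / 2) with hm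
  have hm0 : 0 < m := hpos _ ha
  have he0 : 0 < e := Real.exp_pos _
  -- comparison of the weights with constants
  have hup : ∫ x in (-L / 2)..(L / 2), W x ^ 2 / φ x ^ 2 ≤
      (e / m) ^ 2 * ∫ x in (-L / 2)..(L / 2), W x ^ 2 := by
    rw [← intervalIntegral.integral_const_mul]
    refine intervalIntegral.integral_mono_on hab.le (hI hWφ) ((hI (hWc.pow 2)).const_mul _)
      fun x hx => ?_
    have h1 := (hφ.le_exp_mul_left hL hv hv0 hpos hx).2
    have hx0 := hpos x hx
    rw [div_eq_mul_inv, mul_comm]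
    refine mul_le_mul_of_nonneg_right ?_ (sq_nonneg _)
    rw [← inv_pow]
    refine pow_le_pow_left₀ (by positivity) ?_ 2
    rw [inv_eq_one_div, div_le_div_iff₀ hx0 hm0]
    linarith
  have hW' : ∫ x in (-L / 2)..(L / 2), ((ν - μ) * (φ x * ψ x)) ^ 2 ≤
      ((μ - ν) * (e * m)) ^ 2 * ∫ x in (-L / 2)..(L / 2), ψ x ^ 2 := by
    rw [← intervalIntegral.integral_const_mul]
    refine intervalIntegral.integral_mono_on hab.le (hI (by fun_prop))
      (hI (by fun_prop)) fun x hx => ?_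
    have h1 := (hφ.le_exp_mul_left hL hv hv0 hpos hx).1
    have hx0 := hpos x hx
    calc ((ν - μ) * (φ x * ψ x)) ^ 2 = ((μ - ν) * φ x) ^ 2 * ψ x ^ 2 := by ring
      _ ≤ ((μ - ν) * (e * m)) ^ 2 * ψ x ^ 2 := by gcongr
  have hwirt := dirichlet_wirtinger hL hWd (by fun_prop) hWa hWb
  set A := ∫ x in (-L / 2)..(L / 2), ψ x ^ 2
  set B := ∫ x in (-L / 2)..(L / 2), W x ^ 2
  have hkey : (Real.pi / L) ^ 2 ≤ (μ - ν) * e ^ 4 := by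
    have h1 : (Real.pi / L) ^ 2 * ((μ - ν) * A) ≤ (e / m) ^ 2 * (((μ - ν) * (e * m)) ^ 2 * A) := by
      calc (Real.pi / L) ^ 2 * ((μ - ν) * A) ≤ (Real.pi / L) ^ 2 * ((e / m) ^ 2 * B) := by
            rw [hid]; gcongr
        _ = (e / m) ^ 2 * ((Real.pi / L) ^ 2 * B) := by ring
        _ ≤ _ := mul_le_mul_of_nonneg_left (hwirt.trans hW') (by positivity)
    -- The normalisation `m` cancels, leaving two factors `e²`, one from each replacement of a
    -- weight.
    have h2 : (e / m) ^ 2 * (((μ - ν) * (e * m)) ^ 2 * A) = ((μ - ν) * e ^ 4) * ((μ - ν) * A) := by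
      field_simp
    rw [h2] at h1
    exact le_of_mul_le_mul_right h1 (by positivity)
  have hN : 0 ≤ ∫ t in (-L / 2)..(L / 2), v t :=
    intervalIntegral.integral_nonneg hab.le fun x _ => hv0 x
  -- `e⁴ = exp(4L‖v‖₁)`, so the exponent `8` leaves a factor of two to spare.
  have he4 : Real.exp (-8 * L * ∫ t in (-L / 2)..(L / 2), v t) * e ^ 4 ≤ 1 := by
    rw [he, ← Real.exp_nat_mul, ← Real.exp_add, Real.exp_le_one_iff]
    push_cast
    nlinarith [mul_nonneg hN hL.le]
  calc Real.exp (-8 * L * ∫ t in (-L / 2)..(L / 2), v t) * (Real.pi ^ 2 / L ^ 2)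
      = Real.exp (-8 * L * ∫ t in (-L / 2)..(L / 2), v t) * (Real.pi / L) ^ 2 := by rw [div_pow]
    _ ≤ Real.exp (-8 * L * ∫ t in (-L / 2)..(L / 2), v t) * ((μ - ν) * e ^ 4) := by gcongr
    _ = (μ - ν) * (Real.exp (-8 * L * ∫ t in (-L / 2)..(L / 2), v t) * e ^ 4) := by ring
    _ ≤ μ - ν := mul_le_of_le_one_right hΓ.le he4

end IsRealSolution

/-! ### Carathéodory equations by a weighted contraction. -/

/-- The function `t ↦ exp (2 C (t - a)) η t`, with `η` extended by constants outside `[a, b]`. -/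
def weightedExtend {a b : ℝ} (hab : a ≤ b) (C : ℝ) (η : C(Icc a b, ℝ)) (t : ℝ) : ℝ :=
  Real.exp (2 * C * (t - a)) * IccExtend hab η t

theorem continuous_weightedExtend {a b : ℝ} (hab : a ≤ b) (C : ℝ) (η : C(Icc a b, ℝ)) :
    Continuous (weightedExtend hab C η) :=
  (by fun_prop : Continuous fun t : ℝ => Real.exp (2 * C * (t - a))).mul η.continuous.Icc_extend'

theorem abs_weightedExtend_sub_le {a b : ℝ} (hab : a ≤ b) (C : ℝ) (η ξ : C(Icc a b, ℝ)) (t : ℝ) :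
    |weightedExtend hab C η t - weightedExtend hab C ξ t| ≤
      Real.exp (2 * C * (t - a)) * dist η ξ := by
  rw [weightedExtend, weightedExtend, ← mul_sub, abs_mul, abs_of_pos (Real.exp_pos _)]
  exact mul_le_mul_of_nonneg_left (by
    rw [← Real.dist_eq]
    exact ContinuousMap.dist_apply_le_dist (projIcc a b hab t)) (Real.exp_pos _).le

/-- The Picard map of `θ' = g(t, θ)`, `θ(a) = 0`, conjugated by the weight `exp (2 C (t - a))`. -/
def weightedPicard {a b : ℝ} (hab : a ≤ b) (C : ℝ) (g : ℝ → ℝ → ℝ)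
    (hg : ∀ θ : ℝ → ℝ, Continuous θ → IntervalIntegrable (fun t => g t (θ t)) volume a b)
    (η : C(Icc a b, ℝ)) : C(Icc a b, ℝ) where
  toFun x := Real.exp (-(2 * C * (x - a))) * ∫ t in a..x, g t (weightedExtend hab C η t)
  continuous_toFun := by
    have h := intervalIntegral.continuousOn_primitive_interval'
      (hg _ (continuous_weightedExtend hab C η)) left_mem_uIcc
    rw [uIcc_of_le hab, continuousOn_iff_continuous_domRestrict] at h
    exact (by fun_prop : Continuous fun x : Icc a b => Real.exp (-(2 * C * ((x : ℝ) - a)))).mul h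

theorem picard_integral_exp {a C x : ℝ} :
    ∫ t in a..x, C * Real.exp (2 * C * (t - a)) = (Real.exp (2 * C * (x - a)) - 1) / 2 := by
  rw [intervalIntegral.integral_eq_sub_of_hasDerivAt
    (f := fun t => Real.exp (2 * C * (t - a)) / 2)]
  · simp; ring
  · intro t _
    refine (((((hasDerivAt_id t).sub_const a).const_mul (2 * C)).exp).div_const 2).congr_deriv ?_
    simp; ring
  · exact Continuous.intervalIntegrable (by fun_prop) _ _

/-- The integral of `C exp(2C(t - a))` is at most half of `exp(2C(x - a))`, which the outer factor
removes. The ratio is thus `1/2` whatever `C` and `b - a`, and one fixed point covers the whole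
interval. -/
theorem contracting_weightedPicard {a b : ℝ} (hab : a ≤ b) {C : ℝ} (hC : 0 < C) {g : ℝ → ℝ → ℝ}
    (hg : ∀ θ : ℝ → ℝ, Continuous θ → IntervalIntegrable (fun t => g t (θ t)) volume a b)
    (hlip : ∀ t x y, |g t x - g t y| ≤ C * |x - y|) :
    ContractingWith (1 / 2) (weightedPicard hab C g hg) := by
  refine ⟨by norm_num, LipschitzWith.of_dist_le_mul fun η ξ => ?_⟩
  rw [ContinuousMap.dist_le (by positivity)]
  rintro ⟨x, hx⟩
  have hsub : uIcc a x ⊆ uIcc a b := by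
    rw [uIcc_of_le hx.1, uIcc_of_le hab]; exact Icc_subset_Icc_right hx.2
  have hi : ∀ η, IntervalIntegrable (fun t => g t (weightedExtend hab C η t)) volume a x :=
    fun η => (hg _ (continuous_weightedExtend hab C η)).mono_set hsub
  have h1 : |(∫ t in a..x, g t (weightedExtend hab C η t)) -
      ∫ t in a..x, g t (weightedExtend hab C ξ t)| ≤
      (Real.exp (2 * C * (x - a)) - 1) / 2 * dist η ξ := by
    rw [← intervalIntegral.integral_sub (hi η) (hi ξ), ← picard_integral_exp,
      ← intervalIntegral.integral_mul_const]
    have hci : IntervalIntegrable (fun t => C * Real.exp (2 * C * (t - a)) * dist η ξ) volume a x :=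
      Continuous.intervalIntegrable (by fun_prop) _ _
    rw [← Real.norm_eq_abs]
    refine intervalIntegral.norm_integral_le_of_norm_le hx.1 (ae_of_all _ fun t _ => ?_) hci
    rw [Real.norm_eq_abs, mul_assoc]
    exact (hlip _ _ _).trans (mul_le_mul_of_nonneg_left (abs_weightedExtend_sub_le hab C η ξ t) hC.le)
  change dist (Real.exp (-(2 * C * (x - a))) * ∫ t in a..x, g t (weightedExtend hab C η t))
    (Real.exp (-(2 * C * (x - a))) * ∫ t in a..x, g t (weightedExtend hab C ξ t)) ≤ _
  rw [Real.dist_eq, ← mul_sub, abs_mul, abs_of_pos (Real.exp_pos _)]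
  calc _ ≤ Real.exp (-(2 * C * (x - a))) * ((Real.exp (2 * C * (x - a)) - 1) / 2 * dist η ξ) := by
        gcongr
    _ = (1 - Real.exp (-(2 * C * (x - a)))) / 2 * dist η ξ := by
        rw [Real.exp_neg]; field_simp
    _ ≤ _ := by
        refine mul_le_mul_of_nonneg_right ?_ dist_nonneg
        push_cast
        linarith [Real.exp_pos (-(2 * C * (x - a)))]

theorem dist_weightedPicard_le {a b : ℝ} (hab : a ≤ b) {C ε : ℝ} (hC : 0 < C) {g h : ℝ → ℝ → ℝ}
    (hg : ∀ θ : ℝ → ℝ, Continuous θ → IntervalIntegrable (fun t => g t (θ t)) volume a b)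
    (hh : ∀ θ : ℝ → ℝ, Continuous θ → IntervalIntegrable (fun t => h t (θ t)) volume a b)
    (hgh : ∀ t x, |g t x - h t x| ≤ ε) (η : C(Icc a b, ℝ)) :
    dist (weightedPicard hab C g hg η) (weightedPicard hab C h hh η) ≤ ε * (b - a) := by
  have hε : 0 ≤ ε := (abs_nonneg _).trans (hgh 0 0)
  rw [ContinuousMap.dist_le (mul_nonneg hε (sub_nonneg.2 hab))]
  rintro ⟨x, hx⟩
  have hsub : uIcc a x ⊆ uIcc a b := by
    rw [uIcc_of_le hx.1, uIcc_of_le hab]; exact Icc_subset_Icc_right hx.2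
  have hc := continuous_weightedExtend hab C η
  change dist (Real.exp (-(2 * C * (x - a))) * ∫ t in a..x, g t (weightedExtend hab C η t))
    (Real.exp (-(2 * C * (x - a))) * ∫ t in a..x, h t (weightedExtend hab C η t)) ≤ _
  rw [Real.dist_eq, ← mul_sub, abs_mul, abs_of_pos (Real.exp_pos _),
    ← intervalIntegral.integral_sub ((hg _ hc).mono_set hsub) ((hh _ hc).mono_set hsub)]
  have h1 := intervalIntegral.norm_integral_le_of_norm_le_const (a := a) (b := x)
    (f := fun t => g t (weightedExtend hab C η t) - h t (weightedExtend hab C η t))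
    (fun t _ => hgh t _)
  have h2 : Real.exp (-(2 * C * (x - a))) ≤ 1 :=
    Real.exp_le_one_iff.2 (neg_nonpos.2 (mul_nonneg (by positivity) (sub_nonneg.2 hx.1)))
  rw [Real.norm_eq_abs, abs_of_nonneg (sub_nonneg.2 hx.1)] at h1
  refine (mul_le_of_le_one_left (abs_nonneg _) h2).trans (h1.trans ?_)
  exact mul_le_mul_of_nonneg_left (by linarith [hx.2]) hε

/-- Existence and continuous dependence on parameters for a scalar Carathéodory equation
`θ' = G p t θ`, `θ(a) = 0`, with globally Lipschitz right-hand side. -/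
theorem exists_solution_family {P : Type*} [PseudoMetricSpace P] {a b : ℝ} (hab : a ≤ b)
    {G : P → ℝ → ℝ → ℝ} {C D : ℝ} (hC : 0 < C)
    (hG : ∀ p, ∀ θ : ℝ → ℝ, Continuous θ → IntervalIntegrable (fun t => G p t (θ t)) volume a b)
    (hlip : ∀ p t x y, |G p t x - G p t y| ≤ C * |x - y|)
    (hpar : ∀ p q t x, |G p t x - G q t x| ≤ D * dist p q) :
    ∃ Θ : P → ℝ → ℝ, (∀ p, Continuous (Θ p)) ∧
      (∀ p, ∀ x ∈ Icc a b, Θ p x = ∫ t in a..x, G p t (Θ p t)) ∧ Continuous fun p => Θ p b := by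
  have hcontr := fun p => contracting_weightedPicard hab hC (hG p) (hlip p)
  set η : P → C(Icc a b, ℝ) := fun p => ContractingWith.fixedPoint _ (hcontr p) with hη
  have hfix : ∀ p, weightedPicard hab C (G p) (hG p) (η p) = η p :=
    fun p => (hcontr p).fixedPoint_isFixedPt
  refine ⟨fun p => weightedExtend hab C (η p), fun p => continuous_weightedExtend hab C _,
    fun p x hx => ?_, ?_⟩
  · have h1 := congrArg (fun f : C(Icc a b, ℝ) => f ⟨x, hx⟩) (hfix p)
    change Real.exp (-(2 * C * (x - a))) * ∫ t in a..x, G p t (weightedExtend hab C (η p) t) =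
      η p ⟨x, hx⟩ at h1
    change Real.exp (2 * C * (x - a)) * IccExtend hab (η p) x = _
    rw [IccExtend_of_mem hab _ hx, ← h1, ← mul_assoc, ← Real.exp_add, add_neg_cancel,
      Real.exp_zero, one_mul]
  -- Fixed points of `1/2`-contractions differ by at most `1/(1 - 1/2) = 2` times the distance of
  -- the maps, which is at most `D (b - a) dist p q`.
  · have hηL : LipschitzWith (D * (b - a) * 2).toNNReal η := LipschitzWith.of_dist_le' fun p q => by
      have := (hcontr p).dist_fixedPoint_fixedPoint_of_dist_le' _ (hfix p) (hfix q)
        fun ξ => dist_weightedPicard_le hab hC (hG p) (hG q) (hpar p q) ξ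
      refine this.trans (le_of_eq ?_)
      push_cast
      ring
    refine continuous_const.mul ?_
    rw [show (fun p => IccExtend hab (η p) b) = fun p => η p ⟨b, hab, le_rfl⟩ from
      funext fun p => IccExtend_of_mem hab _ ⟨hab, le_rfl⟩]
    exact (continuous_eval_const _).comp hηL.continuous

/-! ### Prüfer angles and existence of eigenfunctions by shooting. -/

/-- The right-hand side of the scaled Prüfer equation `θ' = q cos² θ + ω sin² θ`. -/
def prueferField (ω q θ : ℝ) : ℝ := q + (ω - q) * Real.sin θ ^ 2

theorem prueferField_eq (ω q θ : ℝ) :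
    prueferField ω q θ = q * Real.cos θ ^ 2 + ω * Real.sin θ ^ 2 := by
  rw [prueferField, Real.cos_sq']; ring

theorem abs_sin_sq_sub_le (x y : ℝ) : |Real.sin x ^ 2 - Real.sin y ^ 2| ≤ |x - y| := by
  have h : Real.sin x ^ 2 - Real.sin y ^ 2 = Real.sin (x + y) * Real.sin (x - y) := by
    rw [Real.sin_add, Real.sin_sub]
    nlinarith [Real.sin_sq_add_cos_sq x, Real.sin_sq_add_cos_sq y]
  rw [h, abs_mul]
  exact (mul_le_of_le_one_left (abs_nonneg _) (Real.abs_sin_le_one _)).trans Real.abs_sin_le_abs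

/-- A solution of the Prüfer equation yields a Neumann eigenfunction. -/
theorem isRealSolution_of_pruefer {v : ℝ → ℝ} {L ω ν : ℝ} (hL : 0 < L) (hω : ω ≠ 0)
    (hv : IntervalIntegrable v volume (-L / 2) (L / 2)) {θ : ℝ → ℝ}
    (hθ : HasAEDeriv (-L / 2) (L / 2) θ fun t => prueferField ω ((ν - v t) / ω) (θ t))
    (h0 : θ (-L / 2) = 0) (h1 : Real.sin (θ (L / 2)) = 0) :
    ∃ R : ℝ → ℝ, IsRealSolution v L ν (fun x => Real.exp (R x) * Real.cos (θ x))
      (fun x => -ω * (Real.exp (R x) * Real.sin (θ x))) := by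
  have hab : -L / 2 ≤ L / 2 := by linarith
  have hθc := hθ.continuousOn hab
  -- The logarithmic derivative of the amplitude, forced by requiring `(exp R cos θ)' = -ω exp R sin
  -- θ`.
  set ρ : ℝ → ℝ := fun t => ((ν - v t) / ω - ω) * (Real.sin (θ t) * Real.cos (θ t)) with hρ
  have hρi : IntervalIntegrable ρ volume (-L / 2) (L / 2) := by
    refine IntervalIntegrable.mul_continuousOn
      (((intervalIntegrable_const.sub hv).div_const ω).sub intervalIntegrable_const) ?_
    rw [uIcc_of_le hab]
    fun_prop
  set R : ℝ → ℝ := fun x => ∫ t in (-L / 2)..x, ρ t with hR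
  have hRd : HasAEDeriv (-L / 2) (L / 2) R ρ := .of_integral hab hρi fun x _ => by simp [hR]
  have hRc := hRd.continuousOn hab
  have hexp := hRd.comp Real.hasDerivAt_exp Real.continuous_exp
  have hcos := hθ.comp Real.hasDerivAt_cos Real.continuous_sin.neg
  have hsin := hθ.comp Real.hasDerivAt_sin Real.continuous_cos
  have hy := (hexp.mul hcos).congr_right
    (g := fun x => -ω * (Real.exp (R x) * Real.sin (θ x))) fun x _ => by
      simp only [hρ, prueferField_eq]
      have := Real.sin_sq_add_cos_sq (θ x)
      linear_combination (-ω * Real.exp (R x) * Real.sin (θ x)) * this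
  have hy1 := ((hexp.mul hsin).const_mul (-ω)).congr_right
    (g := fun x => (v x - ν) * (Real.exp (R x) * Real.cos (θ x))) fun x _ => by
      simp only [hρ, prueferField_eq]
      have := Real.sin_sq_add_cos_sq (θ x)
      field_simp
      linear_combination ((v x - ν) * Real.cos (θ x)) * this
  refine ⟨R, ⟨fun x hx => hy.hasDerivWithinAt hab (by fun_prop) hx, fun x hx => ?_, ?_⟩⟩
  · rw [hy1.integral_eq le_rfl hx.1 hx.2]
    simp [h0]
  · simp [h1]

section

variable {v : ℝ → ℝ} {K L ω ν : ℝ} {θ : ℝ → ℝ}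

theorem abs_prueferField_sub_le {q Q : ℝ} (hω : 0 < ω) (hq : |q| ≤ Q) (x y : ℝ) :
    |prueferField ω q x - prueferField ω q y| ≤ (ω + Q) * |x - y| := by
  rw [prueferField, prueferField, add_sub_add_left_eq_sub, ← mul_sub, abs_mul]
  refine mul_le_mul ?_ (abs_sin_sq_sub_le x y) (abs_nonneg _) (by linarith [abs_nonneg q])
  refine (abs_sub _ _).trans ?_
  rw [abs_of_pos hω]
  linarith

/-- The Prüfer angles, depending continuously on the spectral parameter `ν ∈ [α, β]`. -/
theorem exists_prueferAngle (hL : 0 < L) (hω : 0 < ω) (hvm : Measurable v)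
    (hvK : ∀ x, |v x| ≤ K) (α β : ℝ) :
    ∃ Θ : Icc α β → ℝ → ℝ, (∀ p, Θ p (-L / 2) = 0) ∧
      (∀ p, HasAEDeriv (-L / 2) (L / 2) (Θ p)
        fun t => prueferField ω ((p - v t) / ω) (Θ p t)) ∧ Continuous fun p => Θ p (L / 2) := by
  have hab : -L / 2 ≤ L / 2 := by linarith
  have hK : 0 ≤ K := (abs_nonneg _).trans (hvK 0)
  set Q := (max |α| |β| + K) / ω with hQ
  have hq : ∀ (p : Icc α β) t, |(p - v t) / ω| ≤ Q := by
    intro p t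
    rw [abs_div, abs_of_pos hω, hQ]
    refine div_le_div_of_nonneg_right ((abs_sub _ _).trans ?_) hω.le
    exact add_le_add (abs_le_max_abs_abs p.2.1 p.2.2) (hvK t)
  have hQ0 : 0 ≤ Q := by positivity
  have hG : ∀ p : Icc α β, ∀ θ : ℝ → ℝ, Continuous θ →
      IntervalIntegrable (fun t => prueferField ω ((p - v t) / ω) (θ t)) volume (-L / 2) (L / 2) := by
    intro p θ hθ
    have hm : Measurable fun t => prueferField ω ((p - v t) / ω) (θ t) := by
      unfold prueferField
      have := hθ.measurable
      fun_prop
    refine (intervalIntegrable_const (c := ω + Q + Q)).mono_fun' hm.aestronglyMeasurable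
      (ae_of_all _ fun t => ?_)
    have h1 := hq p t
    change |prueferField ω ((p - v t) / ω) (θ t)| ≤ ω + Q + Q
    rw [prueferField]
    refine (abs_add_le _ _).trans ?_
    rw [abs_mul]
    have h2 : |Real.sin (θ t) ^ 2| ≤ 1 := by
      rw [abs_of_nonneg (sq_nonneg _)]; exact Real.sin_sq_le_one _
    have h3 : |ω - (p - v t) / ω| ≤ ω + Q := by
      refine (abs_sub _ _).trans ?_
      rw [abs_of_pos hω]; linarith
    nlinarith [mul_le_mul h3 h2 (abs_nonneg _) (by positivity)]
  obtain ⟨Θ, hc, hint, hΘ⟩ := exists_solution_family hab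
    (G := fun (p : Icc α β) t x => prueferField ω ((p - v t) / ω) x) (C := ω + Q) (D := 1 / ω)
    (by positivity) hG (fun p t x y => abs_prueferField_sub_le hω (hq p t) x y)
    (fun p q t x => by
      rw [prueferField_eq, prueferField_eq, add_sub_add_right_eq_sub, ← sub_mul, abs_mul,
        ← sub_div, sub_sub_sub_cancel_right, abs_div, abs_of_pos hω, abs_of_nonneg (sq_nonneg (Real.cos x)),
        Subtype.dist_eq, Real.dist_eq, one_div_mul_eq_div]
      exact mul_le_of_le_one_right (by positivity) (Real.cos_sq_le_one _))
  have h0 : ∀ p, Θ p (-L / 2) = 0 := fun p => by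
    rw [hint p _ (left_mem_Icc.2 hab), intervalIntegral.integral_same]
  exact ⟨Θ, h0, fun p => .of_integral hab (hG p _ (hc p)) fun x hx => by
    rw [h0, zero_add, hint p x hx], hΘ⟩

/-- At zeros of the cosine the field equals `ω > 0`. Nearby `cos² θ = sin²(θ - c) ≤ ω/(ω + Q)`,
which is exactly what keeps `ω - (ω + Q)cos² θ` nonnegative. -/
theorem prueferField_nonneg_of_near {q Q c θ : ℝ} (hω : 0 < ω) (hq : |q| ≤ Q)
    (hc : Real.cos c = 0) (hθ : |θ - c| < √(ω / (ω + Q))) : 0 ≤ prueferField ω q θ := by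
  have hQ : 0 ≤ Q := (abs_nonneg q).trans hq
  have hs : Real.sin c ^ 2 = 1 := by have := Real.sin_sq_add_cos_sq c; rw [hc] at this; linarith
  have h1 : Real.cos θ ^ 2 = Real.sin (θ - c) ^ 2 := by
    rw [Real.sin_sub, hc, mul_zero, zero_sub, neg_sq, mul_pow, hs, mul_one]
  have h2 : Real.cos θ ^ 2 ≤ ω / (ω + Q) := by
    rw [h1, ← sq_abs, ← Real.sq_sqrt (show 0 ≤ ω / (ω + Q) by positivity)]
    exact pow_le_pow_left₀ (abs_nonneg _) (Real.abs_sin_le_abs.trans hθ.le) 2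
  rw [le_div_iff₀ (by positivity)] at h2
  rw [prueferField_eq, Real.sin_sq]
  nlinarith [(abs_le.1 hq).1, sq_nonneg (Real.cos θ)]

/-- A Prüfer angle that starts and ends at `0` has positive cosine. -/
theorem cos_pruefer_pos {q : ℝ → ℝ} {Q a b : ℝ} (hω : 0 < ω) (hq : ∀ t, |q t| ≤ Q)
    (hθ : HasAEDeriv a b θ fun t => prueferField ω (q t) (θ t))
    (h0 : θ a = 0) (h1 : θ b = 0) {x : ℝ} (hx : x ∈ Icc a b) : 0 < Real.cos (θ x) := by
  have hab := hx.1.trans hx.2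
  have hQ : 0 ≤ Q := (abs_nonneg _).trans (hq 0)
  have hθc := hθ.continuousOn hab
  set δ := √(ω / (ω + Q)) with hδ
  have hδ0 : 0 < δ := by positivity
  have hδ1 : δ ≤ 1 := Real.sqrt_le_one.2 ((div_le_one (by positivity)).2 (by linarith))
  have hmono : ∀ c, Real.cos c = 0 → ∀ y z, a ≤ y → y ≤ z → z ≤ b →
      (∀ t ∈ Icc y z, |θ t - c| < δ) → θ y ≤ θ z := by
    intro c hc y z hy hyz hz h
    rw [← sub_nonneg, ← hθ.integral_eq hy hyz hz]
    exact intervalIntegral.integral_nonneg hyz fun t ht =>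
      prueferField_nonneg_of_near hω (hq t) hc (h t ht)
  have hπ := Real.pi_gt_three
  apply Real.cos_pos_of_mem_Ioo
  constructor
  -- The barrier is placed `δ/2` above `-π/2` to make the inequality strict; its `δ/2`-neighbourhood
  -- lies in the `δ`-neighbourhood of `-π/2`.
  · have := le_of_forall_near_monotone (c := -(Real.pi / 2) + δ / 2) (half_pos hδ0) hθc
      (by rw [h0]; linarith) (fun y z hy hyz hz h => hmono (-(Real.pi / 2)) (by simp) y z hy hyz hz
        fun t ht => ?_) hx
    · linarith
    · have := abs_lt.1 (h t ht)
      rw [abs_lt]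
      constructor <;> linarith
  -- An angle that has reached `π/2` stays above it, so it could not end at `0`.
  · by_contra! hge
    have := le_of_forall_near_monotone hδ0 (hθc.mono (Icc_subset_Icc_left hx.1)) hge
      (fun y z hy hyz hz h => hmono (Real.pi / 2) (by simp) y z (hx.1.trans hy) hyz hz h)
      (right_mem_Icc.2 hx.2)
    linarith

/-- For `|θ| < π/4` the field is at most `-ω cos 2θ ≤ 0`, so `0` is a barrier for `-θ`. -/
theorem pruefer_nonpos {q : ℝ → ℝ} {a b : ℝ} (hω : 0 < ω) (hq : ∀ t, q t ≤ -ω)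
    (hθ : HasAEDeriv a b θ fun t => prueferField ω (q t) (θ t)) (h0 : θ a = 0)
    {x : ℝ} (hx : x ∈ Icc a b) : θ x ≤ 0 := by
  have hab := hx.1.trans hx.2
  have hπ := Real.pi_gt_three
  have := le_of_forall_near_monotone (θ := fun t => -θ t) (c := 0) (δ := Real.pi / 4) (by positivity)
    (hθ.continuousOn hab).neg (by simp [h0]) (fun y z hy hyz hz h => ?_) hx
  · linarith
  · rw [neg_le_neg_iff, ← sub_nonneg, ← neg_sub, ← hθ.integral_eq hy hyz hz,
      ← intervalIntegral.integral_neg]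
    refine intervalIntegral.integral_nonneg hyz fun t ht => ?_
    have h1 := abs_lt.1 (h t ht)
    have h2 : 0 ≤ Real.cos (2 * θ t) :=
      Real.cos_nonneg_of_mem_Icc ⟨by linarith, by linarith⟩
    rw [Real.cos_two_mul, ← sub_nonneg] at h2
    rw [prueferField_eq, Real.sin_sq]
    nlinarith [hq t, sq_nonneg (Real.cos (θ t))]

theorem pruefer_ge {q : ℝ → ℝ} {a b : ℝ} (hab : a ≤ b) (hq : ∀ t, ω ≤ q t)
    (hθ : HasAEDeriv a b θ fun t => prueferField ω (q t) (θ t)) (h0 : θ a = 0) :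
    ω * (b - a) ≤ θ b := by
  have h1 := hθ.integral_eq le_rfl hab le_rfl
  rw [h0, sub_zero] at h1
  rw [← h1]
  calc ω * (b - a) = ∫ _ in a..b, ω := by simp; ring
    _ ≤ _ := by
      refine intervalIntegral.integral_mono_on hab intervalIntegrable_const
        (hθ.intervalIntegrable hab) fun t _ => ?_
      rw [prueferField_eq, Real.sin_sq]
      nlinarith [hq t, sq_nonneg (Real.cos (θ t))]

end

/-- There are a positive Neumann eigenfunction and one that changes sign. -/
theorem exists_eigenfunctions {v : ℝ → ℝ} {K L : ℝ} (hL : 0 < L) (hvm : Measurable v)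
    (hv0 : ∀ x, 0 ≤ v x) (hvK : ∀ x, v x ≤ K) :
    (∃ ν φ φ₁, IsRealSolution v L ν φ φ₁ ∧ ∀ x ∈ Icc (-L / 2) (L / 2), 0 < φ x) ∧
    ∃ ν ψ ψ₁, IsRealSolution v L ν ψ ψ₁ ∧ 0 < ψ (-L / 2) ∧ ψ (L / 2) < 0 := by
  have hab : -L / 2 ≤ L / 2 := by linarith
  have hK : 0 ≤ K := (hv0 0).trans (hvK 0)
  have hvK' : ∀ x, |v x| ≤ K := fun x => by rw [abs_of_nonneg (hv0 x)]; exact hvK x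
  have hvi : IntervalIntegrable v volume (-L / 2) (L / 2) :=
    (intervalIntegrable_const (c := K)).mono_fun' hvm.aestronglyMeasurable (ae_of_all _ hvK')
  -- This scale makes an angular speed of at least `ω` turn the angle by at least `π` over length
  -- `L`.
  set ω := Real.pi / L with hωdef
  have hω : 0 < ω := by positivity
  have hαβ : -ω ^ 2 ≤ K + ω ^ 2 := by nlinarith [sq_nonneg ω]
  -- At `ν = -ω²` the bound `v ≥ 0` gives `q ≤ -ω`; at `ν = K + ω²` the bound `v ≤ K` gives `q ≥ ω`.
  -- The final angle is then at most `0`, respectively at least `π`.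
  obtain ⟨Θ, h0, hΘ, hΘc⟩ := exists_prueferAngle hL hω hvm hvK' (-ω ^ 2) (K + ω ^ 2)
  have hlow : Θ ⟨-ω ^ 2, left_mem_Icc.2 hαβ⟩ (L / 2) ≤ 0 :=
    pruefer_nonpos hω (fun t => by rw [div_le_iff₀ hω]; nlinarith [hv0 t]) (hΘ _) (h0 _)
      (right_mem_Icc.2 hab)
  have hhigh : Real.pi ≤ Θ ⟨K + ω ^ 2, right_mem_Icc.2 hαβ⟩ (L / 2) := by
    refine le_trans (le_of_eq ?_)
      (pruefer_ge hab (fun t => by rw [le_div_iff₀ hω]; nlinarith [hvK t]) (hΘ _) (h0 _))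
    rw [hωdef]; field_simp; ring
  have : PreconnectedSpace (Icc (-ω ^ 2) (K + ω ^ 2)) :=
    Subtype.preconnectedSpace isPreconnected_Icc
  constructor
  · obtain ⟨p, hp⟩ := mem_range_of_exists_le_of_exists_ge hΘc ⟨_, hlow⟩
      ⟨_, Real.pi_pos.le.trans hhigh⟩
    replace hp : Θ p (L / 2) = _ := hp
    obtain ⟨R, hR⟩ := isRealSolution_of_pruefer hL hω.ne' hvi (hΘ p) (h0 p) (by rw [hp]; simp)
    refine ⟨p, _, _, hR, fun x hx => mul_pos (Real.exp_pos _) ?_⟩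
    refine cos_pruefer_pos (Q := (|(p : ℝ)| + K) / ω) hω (fun t => ?_) (hΘ p) (h0 p) hp hx
    rw [abs_div, abs_of_pos hω]
    exact div_le_div_of_nonneg_right ((abs_sub _ _).trans (add_le_add_right (hvK' t) _)) hω.le
  · obtain ⟨p, hp⟩ := mem_range_of_exists_le_of_exists_ge hΘc ⟨_, hlow.trans Real.pi_pos.le⟩
      ⟨_, hhigh⟩
    replace hp : Θ p (L / 2) = _ := hp
    obtain ⟨R, hR⟩ := isRealSolution_of_pruefer hL hω.ne' hvi (hΘ p) (h0 p) (by rw [hp]; simp)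
    refine ⟨p, _, _, hR, ?_, ?_⟩
    · simp only [h0, Real.cos_zero, mul_one, Real.exp_pos]
    · simp only [hp, Real.cos_pi, mul_neg, mul_one, neg_lt_zero, Real.exp_pos]

/-! ### Passage to the operator on `L²` and its eigenvalues. -/

theorem graph_congr {v w : ℝ → ℝ} (h : v =ᵐ[volume] w) (L : ℝ) : graph v L = graph w L := by
  have key : ∀ {v w : ℝ → ℝ}, v =ᵐ[volume] w → graph v L ≤ graph w L := by
    rintro v w h p ⟨f, f₁, f₂, hf, h1, h2⟩
    refine ⟨f, f₁, f₂, hf, h1, ?_⟩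
    filter_upwards [h2, ae_restrict_of_ae h] with x hx hvw
    rw [hx, hvw]
  exact le_antisymm (key h) (key h.symm)

theorem spectralGap_congr {v w : ℝ → ℝ} (h : v =ᵐ[volume] w) (L : ℝ) :
    spectralGap v L = spectralGap w L := by
  simp only [spectralGap, eigenvalue, isEigenfunction_iff, graph_congr h]

/-- Reaches the endpoints, where independence of the two eigenfunctions is tested. -/
theorem eqOn_Icc_of_ae_eq_Ioo {a b : ℝ} (hab : a < b) {f g : ℝ → ℂ}
    (h : f =ᵐ[volume.restrict (Ioo a b)] g) (hf : ContinuousOn f (Icc a b))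
    (hg : ContinuousOn g (Icc a b)) : EqOn f g (Icc a b) := by
  refine Measure.eqOn_Icc_of_ae_eq volume hab.ne ?_ hf hg
  rwa [← Measure.restrict_congr_set (Ioo_ae_eq_Icc (μ := volume))]

theorem memLp_of_continuousOn_Icc {a b : ℝ} {f : ℝ → ℂ} (hf : ContinuousOn f (Icc a b)) :
    MemLp f 2 (volume.restrict (Ioo a b)) := by
  obtain ⟨B, hB⟩ := isCompact_Icc.exists_bound_of_continuousOn hf
  refine MemLp.of_bound
    ((hf.mono Ioo_subset_Icc_self).aestronglyMeasurable measurableSet_Ioo) B ?_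
  filter_upwards [ae_restrict_mem measurableSet_Ioo] with x hx using hB x (Ioo_subset_Icc_self hx)

section

variable {v : ℝ → ℝ} {K L ν : ℝ}

/-- A nonzero real solution of the Neumann problem defines an eigenfunction. -/
theorem IsRealSolution.exists_isEigenfunction {y y₁ : ℝ → ℝ} (hL : 0 < L) (hvm : Measurable v)
    (hvK : ∀ x, |v x| ≤ K) (h : IsRealSolution v L ν y y₁)
    (hne : ∃ x ∈ Icc (-L / 2) (L / 2), y x ≠ 0) :
    ∃ u : L2 L, IsEigenfunction v L ν u ∧
      u =ᵐ[volume.restrict (Ioo (-L / 2) (L / 2))] fun x => (y x : ℂ) := by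
  have hab : -L / 2 < L / 2 := by linarith
  have hvi : IntervalIntegrable v volume (-L / 2) (L / 2) :=
    (intervalIntegrable_const (c := K)).mono_fun' hvm.aestronglyMeasurable (ae_of_all _ hvK)
  have hyc : ContinuousOn (fun x => (y x : ℂ)) (Icc (-L / 2) (L / 2)) :=
    Complex.continuous_ofReal.comp_continuousOn h.continuousOn
  have hf := memLp_of_continuousOn_Icc hyc
  have hf₂ : MemLp (fun x => (((v x - ν) * y x : ℝ) : ℂ)) 2
      (volume.restrict (Ioo (-L / 2) (L / 2))) := by
    refine (hf.norm.const_mul (K + |ν|)).of_le ?_ (ae_of_all _ fun x => ?_)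
    · simp only [Complex.ofReal_mul]
      exact (Complex.measurable_ofReal.comp (hvm.sub_const ν)).aestronglyMeasurable.mul hf.1
    · rw [Complex.norm_real, Complex.norm_real, norm_mul, norm_mul, norm_norm]
      refine mul_le_mul_of_nonneg_right (((norm_sub_le _ _).trans ?_).trans (le_abs_self _))
        (norm_nonneg _)
      exact add_le_add_left (hvK x) _
  have hu := hf.coeFn_toLp
  refine ⟨hf.toLp _, isEigenfunction_iff.2 ⟨fun h0 => ?_, ?_⟩, hu⟩
  · obtain ⟨x, hx, hx0⟩ := hne
    rw [h0] at hu
    have := eqOn_Icc_of_ae_eq_Ioo hab (hu.symm.trans (Lp.coeFn_zero _ _ _)) hyc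
      continuousOn_const hx
    exact hx0 (by simpa using this)
  · refine ⟨fun x => (y x : ℂ), fun x => (y₁ x : ℂ), fun x => (((v x - ν) * y x : ℝ) : ℂ),
      ⟨fun x hx => (h.hasDeriv x hx).ofReal_comp, hf₂, fun x hx => ?_, ?_, ?_⟩, hu, ?_⟩
    · rw [intervalIntegral.integral_ofReal, h.eq_integral x hx]
    · rw [h.left_bc hL, Complex.ofReal_zero]
    · rw [h.right_bc, Complex.ofReal_zero]
    · filter_upwards [hu, Lp.coeFn_smul (ν : ℂ) (hf.toLp _)] with x h1 h2
      change ((ν : ℂ) • hf.toLp _ : L2 L) x = _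
      rw [h2, Pi.smul_apply, h1, smul_eq_mul]
      push_cast
      ring

/-- The real and imaginary parts of an eigenfunction are real solutions of the Neumann problem. -/
theorem IsEigenfunction.exists_isRealSolution {u : L2 L}
    (hu : IsEigenfunction v L ν u) :
    ∃ f f₁ : ℝ → ℂ, u =ᵐ[volume.restrict (Ioo (-L / 2) (L / 2))] f ∧
      ContinuousOn f (Icc (-L / 2) (L / 2)) ∧
      IsRealSolution v L ν (fun x => (f x).re) (fun x => (f₁ x).re) ∧
      IsRealSolution v L ν (fun x => (f x).im) (fun x => (f₁ x).im) := by
  obtain ⟨-, f, f₁, f₂, hf, h1, h2⟩ := isEigenfunction_iff.1 hu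
  have hf₂ : ∀ᵐ x : ℝ, x ∈ Ioc (-L / 2) (L / 2) → f₂ x = ((v x - ν : ℝ) : ℂ) * f x := by
    rw [← ae_restrict_iff' measurableSet_Ioc, ← Measure.restrict_congr_set (Ioo_ae_eq_Ioc (μ := volume))]
    filter_upwards [h1, h2, Lp.coeFn_smul (ν : ℂ) u] with x h1 h2 h3
    rw [h3, Pi.smul_apply, h1, smul_eq_mul] at h2
    push_cast
    linear_combination h2
  have key : ∀ ℓ : ℂ →L[ℝ] ℝ, IsRealSolution v L ν (fun x => ℓ (f x)) (fun x => ℓ (f₁ x)) := by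
    intro ℓ
    refine ⟨fun x hx => ℓ.hasFDerivAt.comp_hasDerivWithinAt x (hf.hasDeriv x hx), fun x hx => ?_, ?_⟩
    · rw [hf.eq_integral x hx, ← ℓ.intervalIntegral_comp_comm (hf.intervalIntegrable hx)]
      refine intervalIntegral.integral_congr_ae ?_
      filter_upwards [hf₂] with t ht htI
      rw [uIoc_of_le hx.1] at htI
      rw [ht ⟨htI.1, htI.2.trans hx.2⟩, ← Complex.real_smul, map_smul, smul_eq_mul]
    · rw [hf.right_bc, map_zero]
  exact ⟨f, f₁, h1, fun x hx => (hf.hasDeriv x hx).continuousWithinAt, key Complex.reCLM,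
    key Complex.imCLM⟩

/-- Every eigenvalue other than that of a positive eigenfunction `φ` exceeds it by the gap bound,
and the eigenfunctions for the eigenvalue of `φ` are multiples of `φ`. -/
theorem IsEigenfunction.eq_smul_or_gap_le {ν₀ : ℝ} {φ φ₁ : ℝ → ℝ} {u w : L2 L} (hL : 0 < L)
    (hv : IntervalIntegrable v volume (-L / 2) (L / 2)) (hv0 : ∀ x, 0 ≤ v x)
    (hφ : IsRealSolution v L ν₀ φ φ₁) (hpos : ∀ x ∈ Icc (-L / 2) (L / 2), 0 < φ x)
    (hw : w =ᵐ[volume.restrict (Ioo (-L / 2) (L / 2))] fun x => (φ x : ℂ))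
    (hu : IsEigenfunction v L ν u) :
    (ν = ν₀ ∧ ∃ c : ℂ, u = c • w) ∨
    Real.exp (-8 * L * ∫ t in (-L / 2)..(L / 2), v t) * (Real.pi ^ 2 / L ^ 2) ≤ ν - ν₀ := by
  obtain ⟨f, f₁, huf, hfc, hre, him⟩ := hu.exists_isRealSolution
  by_cases hν : ν = ν₀
  · subst hν
    obtain ⟨c, hc⟩ := hφ.eq_const_mul hL hv hre hpos
    obtain ⟨d, hd⟩ := hφ.eq_const_mul hL hv him hpos
    refine .inl ⟨rfl, ⟨c, d⟩, Lp.ext ?_⟩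
    filter_upwards [huf, hw, Lp.coeFn_smul (⟨c, d⟩ : ℂ) w, ae_restrict_mem measurableSet_Ioo]
      with x h1 h2 h3 hx
    have hx' := Ioo_subset_Icc_self hx
    rw [h3, Pi.smul_apply, h1, h2]
    apply Complex.ext
    · simp [hc x hx']
    · simp [hd x hx']
  · right
    -- The real or the imaginary part is nonzero, and either one serves as `ψ`.
    by_cases h0 : ∃ x ∈ Icc (-L / 2) (L / 2), (f x).re ≠ 0
    · exact hφ.gap_le hL hv hv0 hre hpos h0 hν
    · refine hφ.gap_le hL hv hv0 him hpos ?_ hν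
      by_contra! h1
      push Not at h0
      refine hu.1 ((Lp.eq_zero_iff_ae_eq_zero).2 ?_)
      filter_upwards [huf, ae_restrict_mem measurableSet_Ioo] with x hx hxI
      rw [hx]
      exact Complex.ext (h0 x (Ioo_subset_Icc_self hxI)) (h1 x (Ioo_subset_Icc_self hxI))

/-- A linear relation evaluated at the two endpoints is a 2×2 system with determinant `φ(-L/2)ψ(L/2)
- φ(L/2)ψ(-L/2) < 0`. -/
theorem linearIndependent_of_sign_change {φ ψ : ℝ → ℝ} {u w : L2 L} (hL : 0 < L)
    (hφ : ContinuousOn φ (Icc (-L / 2) (L / 2))) (hψ : ContinuousOn ψ (Icc (-L / 2) (L / 2)))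
    (hpos : ∀ x ∈ Icc (-L / 2) (L / 2), 0 < φ x) (hψa : 0 < ψ (-L / 2)) (hψb : ψ (L / 2) < 0)
    (hu : u =ᵐ[volume.restrict (Ioo (-L / 2) (L / 2))] fun x => (φ x : ℂ))
    (hw : w =ᵐ[volume.restrict (Ioo (-L / 2) (L / 2))] fun x => (ψ x : ℂ)) :
    LinearIndependent ℂ ![u, w] := by
  have hab : -L / 2 < L / 2 := by linarith
  have ha := left_mem_Icc.2 hab.le
  have hb := right_mem_Icc.2 hab.le
  rw [LinearIndependent.pair_iff]
  intro s t hst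
  have hae : (fun x => s * (φ x : ℂ) + t * (ψ x : ℂ)) =ᵐ[volume.restrict (Ioo (-L / 2) (L / 2))]
      fun _ => (0 : ℂ) := by
    have h0 : ((s • u + t • w : L2 L) : ℝ → ℂ) =ᵐ[volume.restrict (Ioo (-L / 2) (L / 2))] 0 := by
      rw [hst]; exact Lp.coeFn_zero _ _ _
    filter_upwards [h0, Lp.coeFn_add (s • u) (t • w), Lp.coeFn_smul s u, Lp.coeFn_smul t w, hu, hw]
      with x h0 h1 h2 h3 h4 h5
    rw [h1, Pi.add_apply, h2, h3, Pi.smul_apply, Pi.smul_apply, h4, h5] at h0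
    simpa using h0
  have heq := eqOn_Icc_of_ae_eq_Ioo hab hae
    ((continuousOn_const.mul (Complex.continuous_ofReal.comp_continuousOn hφ)).add
      (continuousOn_const.mul (Complex.continuous_ofReal.comp_continuousOn hψ))) continuousOn_const
  have h1 := heq ha
  have h2 := heq hb
  simp only [] at h1 h2
  have hφa := hpos _ ha
  have hφb := hpos _ hb
  have hdet : ((φ (-L / 2) * ψ (L / 2) - φ (L / 2) * ψ (-L / 2) : ℝ) : ℂ) ≠ 0 := by
    rw [Complex.ofReal_ne_zero]
    nlinarith [mul_pos hφa (neg_pos.2 hψb), mul_pos hφb hψa]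
  have ht : t = 0 := by
    refine (mul_eq_zero.1 ?_).resolve_right hdet
    push_cast
    linear_combination (φ (-L / 2) : ℂ) * h2 - (φ (L / 2) : ℂ) * h1
  refine ⟨?_, ht⟩
  rw [ht, zero_mul, add_zero] at h1
  exact (mul_eq_zero.1 h1).resolve_right (Complex.ofReal_ne_zero.2 hφa.ne')

/-- The gap bound for a bounded measurable nonnegative potential. -/
theorem gap_le_spectralGap (hL : 0 < L) (hvm : Measurable v) (hv0 : ∀ x, 0 ≤ v x)
    (hvK : ∀ x, v x ≤ K) :
    Real.exp (-8 * L * ∫ t in (-L / 2)..(L / 2), v t) * (Real.pi ^ 2 / L ^ 2) ≤ spectralGap v L := by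
  have hab : -L / 2 ≤ L / 2 := by linarith
  have hvK' : ∀ x, |v x| ≤ K := fun x => by rw [abs_of_nonneg (hv0 x)]; exact hvK x
  have hvi : IntervalIntegrable v volume (-L / 2) (L / 2) :=
    (intervalIntegrable_const (c := K)).mono_fun' hvm.aestronglyMeasurable (ae_of_all _ hvK')
  obtain ⟨⟨ν₀, φ, φ₁, hφ, hpos⟩, ν₁, ψ, ψ₁, hψ, hψa, hψb⟩ := exists_eigenfunctions hL hvm hv0 hvK
  obtain ⟨w, hw, hwφ⟩ := hφ.exists_isEigenfunction hL hvm hvK'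
    ⟨_, left_mem_Icc.2 hab, (hpos _ (left_mem_Icc.2 hab)).ne'⟩
  obtain ⟨u₁, hu₁, hu₁ψ⟩ := hψ.exists_isEigenfunction hL hvm hvK' ⟨_, left_mem_Icc.2 hab, hψa.ne'⟩
  set g := Real.exp (-8 * L * ∫ t in (-L / 2)..(L / 2), v t) * (Real.pi ^ 2 / L ^ 2) with hg
  have hg0 : 0 ≤ g := by positivity
  have dich : ∀ {ν u}, IsEigenfunction v L ν u → (ν = ν₀ ∧ ∃ c : ℂ, u = c • w) ∨ g ≤ ν - ν₀ :=
    fun hu => hu.eq_smul_or_gap_le hL hvi hv0 hφ hpos hwφ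
  have h0 : eigenvalue v L 0 ≤ ν₀ := by
    -- `ν₀` is also the lower bound: by the dichotomy no eigenvalue lies below it.
    refine csInf_le ⟨ν₀, ?_⟩ ⟨fun _ => w, ?_, fun _ => ⟨ν₀, le_rfl, hw⟩⟩
    · rintro μ ⟨u, -, hu⟩
      obtain ⟨ν, hνμ, hν⟩ := hu 0
      rcases dich hν with ⟨rfl, -⟩ | h
      · exact hνμ
      · linarith
    · have : Subsingleton (Fin (0 + 1)) := inferInstanceAs (Subsingleton (Fin 1))
      exact .of_subsingleton 0 hw.1
  have h1 : ν₀ + g ≤ eigenvalue v L 1 := by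
    -- The sign-changing eigenfunction serves only to make the set nonempty, without which `sInf`
    -- would be `0`; `ν₁` need not be the second eigenvalue.
    refine le_csInf ⟨max ν₀ ν₁, ![w, u₁],
      linearIndependent_of_sign_change hL hφ.continuousOn hψ.continuousOn hpos hψa hψb hwφ hu₁ψ,
      fun i => ?_⟩ ?_
    · fin_cases i
      · exact ⟨ν₀, le_max_left _ _, hw⟩
      · exact ⟨ν₁, le_max_right _ _, hu₁⟩
    · rintro μ ⟨u, hu, hμ⟩
      obtain ⟨α, hαμ, hα⟩ := hμ 0
      obtain ⟨β, hβμ, hβ⟩ := hμ 1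
      -- Two independent eigenfunctions cannot both be multiples of `w`, so one of them has
      -- eigenvalue at least `ν₀ + g`.
      rcases dich hα with ⟨-, c, hc⟩ | h
      · rcases dich hβ with ⟨-, d, hd⟩ | h
        · exfalso
          have hu' : LinearIndependent ℂ ![u 0, u 1] := by
            convert hu using 1
            ext i
            fin_cases i <;> rfl
          have := (LinearIndependent.pair_iff.1 hu' d (-c) (by
            rw [hc, hd, smul_smul, smul_smul, ← add_smul]
            rw [show d * c + -c * d = 0 by ring, zero_smul])).2
          refine hu.ne_zero 0 ?_
          rw [hc, neg_eq_zero.1 this, zero_smul]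
        · linarith
      · linarith
  rw [spectralGap]
  linarith

end

/-- Truncating a measurable representative turns the almost everywhere bounds into pointwise ones;
the operator sees only the class of `v`. -/
theorem exists_bounded_measurable_ae_eq {v : ℝ → ℝ} (hv : MemLp v ⊤ volume)
    (hv0 : ∀ᵐ x : ℝ, 0 ≤ v x) :
    ∃ (w : ℝ → ℝ) (K : ℝ), Measurable w ∧ (∀ x, 0 ≤ w x) ∧ (∀ x, w x ≤ K) ∧ v =ᵐ[volume] w := by
  set K := (eLpNormEssSup v volume).toReal
  have hK : ∀ᵐ x : ℝ, v x ≤ K := by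
    filter_upwards [ae_le_eLpNormEssSup (f := v) (μ := volume)] with x hx
    have hfin : eLpNormEssSup v volume ≠ ⊤ := by
      rw [← eLpNorm_exponent_top]; exact hv.eLpNorm_ne_top
    have := ENNReal.toReal_mono hfin hx
    rw [toReal_enorm] at this
    exact (le_abs_self _).trans this
  have hm := hv.1.aemeasurable
  refine ⟨fun x => min (max (hm.mk v x) 0) K, K, (hm.measurable_mk.max measurable_const).min measurable_const,
    fun x => le_min (le_max_right _ _) ENNReal.toReal_nonneg, fun x => min_le_right _ _, ?_⟩
  filter_upwards [hm.ae_eq_mk, hv0, hK] with x h1 h2 h3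
  rw [← h1, max_eq_left h2, min_eq_left h3]

end NeumannSchrodinger

end

theorem theorem2p3 (v : ℝ → ℝ) (hv : MeasureTheory.MemLp v ⊤ MeasureTheory.volume)
    (hv0 : ∀ᵐ x : ℝ, 0 ≤ v x) (L : ℝ) (hL : 0 < L) :
    NeumannSchrodinger.spectralGap v L ≥
      Real.exp (-8 * L * ∫ x in Set.Ioo (-L / 2) (L / 2), |v x|) * (Real.pi ^ 2 / L ^ 2) := by
  obtain ⟨w, K, hw, hw0, hwK, hvw⟩ := NeumannSchrodinger.exists_bounded_measurable_ae_eq hv hv0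
  have hint : ∫ x in Set.Ioo (-L / 2) (L / 2), |v x| = ∫ x in (-L / 2)..(L / 2), w x := by
    rw [intervalIntegral.integral_of_le (by linarith), MeasureTheory.integral_Ioc_eq_integral_Ioo]
    refine integral_congr_ae (ae_restrict_of_ae ?_)
    filter_upwards [hvw] with x hx
    rw [hx, abs_of_nonneg (hw0 x)]
  rw [hint, NeumannSchrodinger.spectralGap_congr hvw]
  exact NeumannSchrodinger.gap_le_spectralGap hL hw hw0 hwK
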